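/- Distributions are probability measures on $\mathbb R$ concentrated on $[0,\infty)$. For such a distribution $\mu$ write $\overline\mu(x)=\mu((x,\infty))$; for $\gamma\ge 0$ let $m(\mu)=\int_{[0,\infty)}e^{\gamma y}\,\mu(dy)\in(0,\infty]$. $F^{*k}$ is the $k$-fold convolution of $F$ and $F^{*0}$ is the unit mass at $0$. We write $\mu\in\mathcal L(\gamma)$ if $\lim_{x\to\infty}\overline\mu(x-t)/\overline\mu(x)=e^{\gamma t}$ for every $t\in\mathbb R$. If $\gamma>0$ and $\mu$ is lattice with span $d$ (that is, $d>0$ is the largest number such that $\mu$ is concentrated on $d\mathbb Z$), then $x$ and $t$ are restricted to $d\mathbb Z$ in this definition and in condition (a) below. For a random variable $\tau$ with values in $\{0,1,2,\dots\}$ and $p_k=P(\tau=k)$ let $F^{*\tau}=\sum_{k\ge 0}p_kF^{*k}$. **Theorem 2.3.** Let $F$ be a distribution such that $F^{*n}\in\mathcal L(\gamma)$ for some integer $n\ge 1$ and some $\gamma\ge 0$; if $\gamma>0$ and $F^{*n}$ is lattice, assume that $F$ has the same span as $F^{*n}$. Let $P(\tau\ge n)>0$, and suppose that for every $0<\varepsilon<1$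 there is an integer $M$ such that $$\sum_{k=M}^\infty p_{k+1}\overline{F^{*k}}(x)\le\varepsilon\,\overline{F^{*\tau}}(x)\qquad\text{for all }x\ge 0.$$ Suppose further that at least one of the following holds: (a) $\liminf_{x\to\infty}\overline{F^{*i}}(x-t)/\overline{F^{*i}}(x)\ge e^{\gamma t}$ for all $t>0$ and all $1\le i\le n-1$; (b) $\overline F(x)=o\big(\overline{F^{*2}}(x)\big)$ as $x\to\infty$. Then $F^{*\tau}\in\mathcal L(\gamma)$ and $$\liminf_{x\to\infty}\frac{\overline{F^{*\tau}}(x)}{\overline{F^{*n}}(x)}\ \ge\ \sum_{m=1}^\infty m\Big(\sum_{k=nm}^{n(m+1)-1}p_k\Big)\,m(F^{*n})^{m-1},$$ where the right-hand side may be infinite, $0\cdot\infty=0$ and $\infty^0=1$. In particular, if $m(F^{*n})=\infty$ and $P(\tau>n)>0$, then $\overline{F^{*n}}(x)=o\big(\overline{F^{*\tau}}(x)\big)$ as $x\to\infty$. -/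

import Mathlib

open MeasureTheory Set Filter Topology
open scoped ENNReal

namespace RandomConv

/-- The tail `μ(x, ∞)` of a distribution on the real line. -/
noncomputable def tail (μ : Measure ℝ) (x : ℝ) : ℝ≥0∞ := μ (Ioi x)

/-- The `k`-fold convolution of a distribution with itself; the `0`-fold one is the unit mass
at `0`. -/
noncomputable def convPow (F : Measure ℝ) : ℕ → Measure ℝ
  | 0 => Measure.dirac 0
  | k + 1 => (convPow F k).conv F

/-- `μ` is lattice with span `d`: it is concentrated on the integer multiples of `d > 0`, and `d`
is the largest number with this property. -/
def IsLatticeWithSpan (μ : Measure ℝ) (d : ℝ) : Prop :=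
  0 < d ∧ μ ((AddSubgroup.zmultiples d : Set ℝ)ᶜ) = 0 ∧
    ∀ d' : ℝ, d < d' → μ ((AddSubgroup.zmultiples d' : Set ℝ)ᶜ) ≠ 0

/-- The values that `x` and `t` run through in statements about `tail μ (x - t) / tail μ x`: all
real numbers, except that only multiples of the span are used if `γ > 0` and `μ` is lattice. -/
def argSet (γ : ℝ) (μ : Measure ℝ) : Set ℝ :=
  {t | 0 < γ → ∀ d : ℝ, IsLatticeWithSpan μ d → t ∈ AddSubgroup.zmultiples d}

/-- The filter "`x → ∞` through the admissible values". -/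
noncomputable def argTop (γ : ℝ) (μ : Measure ℝ) : Filter ℝ := atTop ⊓ 𝓟 (argSet γ μ)

/-- The class `L(γ)`: the tail at `x - t` is asymptotic to `exp (γ t)` times the tail at `x`, for
every `t`. The limit being positive, this forces `tail μ` to be positive everywhere. -/
def ClassL (γ : ℝ) (μ : Measure ℝ) : Prop :=
  ∀ t ∈ argSet γ μ,
    Tendsto (fun x => tail μ (x - t) / tail μ x) (argTop γ μ) (𝓝 (ENNReal.ofReal (Real.exp (γ * t))))

/-- `liminf tail μ (x - t) / tail μ x ≥ exp (γ t)` for all `t > 0`. -/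
def LiminfCond (γ : ℝ) (μ : Measure ℝ) : Prop :=
  ∀ t ∈ argSet γ μ, 0 < t →
    ENNReal.ofReal (Real.exp (γ * t)) ≤ liminf (fun x => tail μ (x - t) / tail μ x) (argTop γ μ)

/-- The tail of `μ` is `o` of the tail of `ν`. -/
def TailLittleO (μ ν : Measure ℝ) : Prop :=
  Tendsto (fun x => tail μ x / tail ν x) atTop (𝓝 0)

/-- The exponential moment `∫_{[0,∞)} exp (γ y) μ(dy)`, possibly infinite. -/
noncomputable def expMoment (γ : ℝ) (μ : Measure ℝ) : ℝ≥0∞ :=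
  ∫⁻ y in Ici 0, ENNReal.ofReal (Real.exp (γ * y)) ∂μ

/-- The probability `P(τ = k)`. -/
noncomputable def prob {Ω : Type*} [MeasurableSpace Ω] (P : Measure Ω) (τ : Ω → ℕ) (k : ℕ) :
    ℝ≥0∞ :=
  P {ω | τ ω = k}

/-- The random convolution `∑ k, P(τ = k) F^{*k}`. -/
noncomputable def randomConv {Ω : Type*} [MeasurableSpace Ω] (P : Measure Ω) (τ : Ω → ℕ)
    (F : Measure ℝ) : Measure ℝ :=
  Measure.sum fun k => prob P τ k • convPow F k

/-- The uniform tail-sum condition: for any `0 < ε < 1` there is an `M` such that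
`∑_{k ≥ M} P(τ = k + 1) tail F^{*k} (x) ≤ ε tail F^{*τ} (x)` for all `x ≥ 0`. -/
def TailSumCond {Ω : Type*} [MeasurableSpace Ω] (P : Measure Ω) (τ : Ω → ℕ) (F : Measure ℝ) :
    Prop :=
  ∀ ε : ℝ, 0 < ε → ε < 1 → ∃ M : ℕ, ∀ x : ℝ, 0 ≤ x →
    ∑' k : {k : ℕ // M ≤ k}, prob P τ (k + 1) * tail (convPow F k) x
      ≤ ENNReal.ofReal ε * tail (randomConv P τ F) x

end RandomConv

/-! Everything rests on the relation `tail μ (x - t) = exp (γ t) * tail μ x + o(tail κ x)`, split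
into `ShiftUpper` and `ShiftLower`. Both halves survive convolution (`ShiftUpper.conv`,
`ShiftLower.conv`): for `X + Y > x`, either `Y` is bounded and `x - Y` is far out, or `Y` itself is
far out. In the lower bound a window of length `t` for `Y` gets lost; averaging over many disjoint
windows makes the loss negligible (`le_tailOn_compl_shift`).

Hence all powers of `F` satisfy the relation once the powers below `n` do so up to `o(tail F^{*n})`.
Under (b) their tails are themselves of that order (`tail_convPow_le_succ`). Under (a) the lower
half is given and the upper half comes from deconvolution: write `F^{*n} = F^{*i} * F^{*(n-i)}` and
subtract from the upper bound for `F^{*n}` the lower bound on `Y ∉ I`, where `I` is a short interval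
of positive mass. What is left is an upper bound for `F^{*i}` (`tail_shift_le_of_Icc`). In the
mixture finitely many powers are treated one by one; for the others an estimate uniform in `k`
leaves a tail of `F^{*(k-1)}`, which the tail-sum condition controls (`shiftUpper_mixture`,
`shiftLower_mixture`).

The liminf bound is Fatou's lemma. With `G = F^{*n}`, any one of the `m` summands of `G^{*m}` can be
the large one, and each such case contributes `m(G)^(m-1)` (`le_liminf_tail_convPow`). If `m(G)` is
infinite, so is the moment of `F`, and one more factor `F` already makes the tail of larger order.
-/

namespace RandomConv

/-! ### Tails of convolutions and asymptotic shift bounds. -/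

section Tail

variable {μ ν κ : Measure ℝ}

lemma tail_antitone (μ : Measure ℝ) : Antitone (tail μ) :=
  fun _ _ h => measure_mono (Ioi_subset_Ioi h)

lemma measurable_tail (μ : Measure ℝ) : Measurable (tail μ) := (tail_antitone μ).measurable

lemma measurable_tail_sub (μ : Measure ℝ) (x : ℝ) : Measurable fun y => tail μ (x - y) :=
  (measurable_tail μ).comp (measurable_const.sub measurable_id)

lemma tail_le_one [IsProbabilityMeasure μ] (x : ℝ) : tail μ x ≤ 1 := prob_le_one

lemma tail_ne_top [IsProbabilityMeasure μ] (x : ℝ) : tail μ x ≠ ∞ := measure_ne_top _ _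

/-- `P(X + Y > x, Y ∈ S)` for independent `X ~ μ` and `Y ~ ν`. -/
noncomputable def tailOn (μ ν : Measure ℝ) (S : Set ℝ) (x : ℝ) : ℝ≥0∞ :=
  ∫⁻ y in S, tail μ (x - y) ∂ν

lemma tail_conv [SFinite μ] [SFinite ν] (x : ℝ) :
    tail (μ.conv ν) x = ∫⁻ y, tail μ (x - y) ∂ν := by
  rw [tail, Measure.conv, Measure.map_apply (by fun_prop) measurableSet_Ioi,
    Measure.prod_apply_symm (measurableSet_Ioi.preimage (by fun_prop))]
  refine lintegral_congr fun y => congrArg μ ?_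
  ext u
  simp [sub_lt_iff_lt_add]

lemma tailOn_add_compl [SFinite μ] [SFinite ν] {S : Set ℝ} (hS : MeasurableSet S) (x : ℝ) :
    tailOn μ ν S x + tailOn μ ν Sᶜ x = tail (μ.conv ν) x := by
  rw [tail_conv]
  exact lintegral_add_compl _ hS

lemma tailOn_Iic_add_Ioi [SFinite μ] [SFinite ν] (B x : ℝ) :
    tailOn μ ν (Iic B) x + tailOn μ ν (Ioi B) x = tail (μ.conv ν) x := by
  rw [← compl_Iic, tailOn_add_compl measurableSet_Iic]

lemma tailOn_mono {S T : Set ℝ} (h : S ⊆ T) (x : ℝ) : tailOn μ ν S x ≤ tailOn μ ν T x :=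
  lintegral_mono_set h

lemma tailOn_le [SFinite μ] [SFinite ν] (S : Set ℝ) (x : ℝ) :
    tailOn μ ν S x ≤ tail (μ.conv ν) x := by
  rw [tail_conv]
  exact setLIntegral_le_lintegral _ _

lemma tailOn_union {S T : Set ℝ} (hT : MeasurableSet T) (h : Disjoint S T) (x : ℝ) :
    tailOn μ ν (S ∪ T) x = tailOn μ ν S x + tailOn μ ν T x :=
  lintegral_union hT h

/-- Conditioning on the other summand: `Y` has to exceed both `x - u` and `B`. So only values of
`tail ν` at arguments `≥ B` enter. -/
lemma tailOn_Ioi [SFinite μ] [SFinite ν] (B x : ℝ) :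
    tailOn μ ν (Ioi B) x = ∫⁻ u, tail ν (max (x - u) B) ∂μ := by
  have hs : MeasurableSet {p : ℝ × ℝ | x < p.1 + p.2 ∧ B < p.2} :=
    (measurableSet_lt measurable_const (measurable_fst.add measurable_snd)).inter
      (measurableSet_lt measurable_const measurable_snd)
  have h1 : (μ.prod ν) {p : ℝ × ℝ | x < p.1 + p.2 ∧ B < p.2} = tailOn μ ν (Ioi B) x := by
    rw [Measure.prod_apply_symm hs, tailOn, ← lintegral_indicator measurableSet_Ioi]
    refine lintegral_congr fun y => ?_
    by_cases hy : B < y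
    · rw [indicator_of_mem (mem_Ioi.2 hy)]
      refine congrArg μ ?_
      ext u
      simp [sub_lt_iff_lt_add, hy]
    · rw [indicator_of_notMem (by simpa using hy)]
      simp [hy]
  rw [← h1, Measure.prod_apply hs]
  refine lintegral_congr fun u => congrArg ν ?_
  ext y
  simp [sub_lt_iff_lt_add']

lemma tail_le_tail_conv [SFinite μ] [IsProbabilityMeasure ν] (hν : ν (Iio 0) = 0) (x : ℝ) :
    tail μ x ≤ tail (μ.conv ν) x := by
  rw [tail_conv]
  calc tail μ x = ∫⁻ _, tail μ x ∂ν := by simp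
    _ ≤ ∫⁻ y, tail μ (x - y) ∂ν := by
      refine lintegral_mono_ae ?_
      have : ∀ᵐ y ∂ν, 0 ≤ y := by
        rw [ae_iff]; simpa [Iio] using hν
      filter_upwards [this] with y hy
      exact tail_antitone μ (by linarith)

/-- The shifted tail is at most a constant multiple of the tail. -/
def ShiftBounded (κ : Measure ℝ) : Prop :=
  ∀ B : ℝ, ∃ C : ℝ≥0∞, C ≠ ∞ ∧ ∀ x, tail κ (x - B) ≤ C * tail κ x

/-- The constant is unchanged by convolution, so one `C` serves all powers from `n` on. -/
lemma tail_conv_shift_le [SFinite μ] [SFinite ν] {B : ℝ} {C : ℝ≥0∞}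
    (h : ∀ x, tail ν (x - B) ≤ C * tail ν x) (x : ℝ) :
    tail (μ.conv ν) (x - B) ≤ C * tail (μ.conv ν) x := by
  rw [Measure.conv_comm, tail_conv, tail_conv,
    ← lintegral_const_mul _ (measurable_tail_sub _ _)]
  refine lintegral_mono fun y => ?_
  have := h (x - y)
  rwa [show x - y - B = x - B - y by ring] at this

lemma ShiftBounded.conv [SFinite μ] [SFinite ν] (h : ShiftBounded ν) :
    ShiftBounded (μ.conv ν) := fun B => by
  obtain ⟨C, hC, h⟩ := h B
  exact ⟨C, hC, tail_conv_shift_le h⟩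

/-- Asymptotic upper bound for `tail μ (x - t)` by `E * tail μ x`, up to `o(tail κ x)`. -/
def ShiftUpper (E : ℝ≥0∞) (t : ℝ) (μ κ : Measure ℝ) : Prop :=
  ∀ ε : ℝ≥0∞, ε ≠ 0 → ∀ᶠ x in atTop, tail μ (x - t) ≤ E * tail μ x + ε * tail κ x

/-- Asymptotic lower bound for `tail μ (x - t)` by `E * tail μ x`, up to `o(tail κ x)`. -/
def ShiftLower (E : ℝ≥0∞) (t : ℝ) (μ κ : Measure ℝ) : Prop :=
  ∀ ε : ℝ≥0∞, ε ≠ 0 → ∀ᶠ x in atTop, E * tail μ x ≤ tail μ (x - t) + ε * tail κ x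

lemma ShiftLower.mono {E : ℝ≥0∞} {t : ℝ} {κ' : Measure ℝ} (h : ShiftLower E t μ κ)
    (hκ : ∀ x, tail κ x ≤ tail κ' x) : ShiftLower E t μ κ' := fun ε hε =>
  (h ε hε).mono fun x hx => hx.trans (by gcongr; exact hκ x)

variable {E ε : ℝ≥0∞} {t B : ℝ}

/-- Since `max (x - t - u) B = max (x - u) (B + t) - t`, shifting `x` by `t` moves the cut for `Y`
from `B` to `B + t`. -/
lemma tailOn_Ioi_shift_le [SFinite μ] [SFinite ν]
    (h : ∀ u, B + t ≤ u → tail ν (u - t) ≤ E * tail ν u + ε * tail ν u) (x : ℝ) :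
    tailOn μ ν (Ioi B) (x - t) ≤ (E + ε) * tailOn μ ν (Ioi (B + t)) x := by
  rw [tailOn_Ioi, tailOn_Ioi, ← lintegral_const_mul]
  · refine lintegral_mono fun u => ?_
    have := h (max (x - u) (B + t)) (le_max_right _ _)
    rw [← add_mul] at this
    refine le_trans (le_of_eq ?_) this
    congr 1
    rw [← max_sub_sub_right]
    congr 1 <;> ring
  · exact (measurable_tail ν).comp (by fun_prop)

lemma le_tailOn_Ioi_shift [SFinite μ] [SFinite ν]
    (h : ∀ u, B + t ≤ u → E * tail ν u ≤ tail ν (u - t) + ε * tail ν u) (x : ℝ) :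
    E * tailOn μ ν (Ioi (B + t)) x ≤
      tailOn μ ν (Ioi B) (x - t) + ε * tailOn μ ν (Ioi (B + t)) x := by
  have hm (a b : ℝ) : Measurable fun u => tail ν (max (a - u) b) :=
    (measurable_tail ν).comp (by fun_prop)
  rw [tailOn_Ioi, tailOn_Ioi, ← lintegral_const_mul _ (hm _ _), ← lintegral_const_mul _ (hm _ _),
    ← lintegral_add_left (hm _ _)]
  refine lintegral_mono fun u => ?_
  refine (h (max (x - u) (B + t)) (le_max_right _ _)).trans (le_of_eq ?_)
  congr 2
  rw [← max_sub_sub_right]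
  congr 1 <;> ring

lemma setLIntegral_tail_sub_le [IsProbabilityMeasure ν] {S : Set ℝ} (hS : S ⊆ Iic B)
    (hSm : MeasurableSet S) (x : ℝ) :
    ∫⁻ y in S, tail κ (x - y) ∂ν ≤ tail κ (x - B) := by
  calc ∫⁻ y in S, tail κ (x - y) ∂ν ≤ ∫⁻ _ in S, tail κ (x - B) ∂ν :=
        setLIntegral_mono' hSm fun y hy => tail_antitone κ (by have := hS hy; simp at this; linarith)
    _ = tail κ (x - B) * ν S := by simp
    _ ≤ tail κ (x - B) := mul_le_of_le_one_right' prob_le_one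

lemma tailOn_shift_le [IsProbabilityMeasure ν] {x₀ : ℝ}
    (h : ∀ u, x₀ ≤ u → tail μ (u - t) ≤ E * tail μ u + ε * tail κ u) {S : Set ℝ}
    (hS : S ⊆ Iic B) (hSm : MeasurableSet S) {x : ℝ} (hx : x₀ + B ≤ x) :
    tailOn μ ν S (x - t) ≤ E * tailOn μ ν S x + ε * tail κ (x - B) := by
  calc tailOn μ ν S (x - t)
      ≤ ∫⁻ y in S, (E * tail μ (x - y) + ε * tail κ (x - y)) ∂ν := by
        refine setLIntegral_mono' hSm fun y hy => ?_
        have hy' := hS hy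
        simp only [mem_Iic] at hy'
        have := h (x - y) (by linarith)
        rwa [show x - y - t = x - t - y by ring] at this
    _ = E * tailOn μ ν S x + ε * ∫⁻ y in S, tail κ (x - y) ∂ν := by
        rw [lintegral_add_left ((measurable_tail_sub _ _).const_mul _),
          lintegral_const_mul _ (measurable_tail_sub _ _),
          lintegral_const_mul _ (measurable_tail_sub _ _), tailOn]
    _ ≤ _ := by gcongr; exact setLIntegral_tail_sub_le hS hSm x

lemma le_tailOn_shift [IsProbabilityMeasure ν] {x₀ : ℝ}
    (h : ∀ u, x₀ ≤ u → E * tail μ u ≤ tail μ (u - t) + ε * tail κ u) {S : Set ℝ}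
    (hS : S ⊆ Iic B) (hSm : MeasurableSet S) {x : ℝ} (hx : x₀ + B ≤ x) :
    E * tailOn μ ν S x ≤ tailOn μ ν S (x - t) + ε * tail κ (x - B) := by
  calc E * tailOn μ ν S x
      = ∫⁻ y in S, E * tail μ (x - y) ∂ν := by
        rw [lintegral_const_mul _ (measurable_tail_sub _ _), tailOn]
    _ ≤ ∫⁻ y in S, (tail μ (x - t - y) + ε * tail κ (x - y)) ∂ν := by
        refine setLIntegral_mono' hSm fun y hy => ?_
        have hy' := hS hy
        simp only [mem_Iic] at hy'
        have := h (x - y) (by linarith)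
        rwa [show x - y - t = x - t - y by ring] at this
    _ = tailOn μ ν S (x - t) + ε * ∫⁻ y in S, tail κ (x - y) ∂ν := by
        rw [lintegral_add_left (measurable_tail_sub _ _),
          lintegral_const_mul _ (measurable_tail_sub _ _), tailOn]
    _ ≤ _ := by gcongr; exact setLIntegral_tail_sub_le hS hSm x

/-- Error terms: `ε * C` can be made at most any given positive bound when `C` is finite. -/
lemma exists_ne_zero_mul_le {C ε : ℝ≥0∞} (hC : C ≠ ∞) (hε : ε ≠ 0) :
    ∃ δ : ℝ≥0∞, δ ≠ 0 ∧ δ ≠ ∞ ∧ δ * C ≤ ε := by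
  obtain ⟨δ, hδ, h⟩ := ENNReal.exists_nnreal_pos_mul_lt hC hε
  exact ⟨δ, by simpa using hδ.ne', ENNReal.coe_ne_top, h.le⟩

/-- Split at `Y = X`, beyond which the bound for `ν` applies. Below the cut the bound for `μ` has an
error at the argument `x - X`, absorbed by shift-boundedness. The moved cut is harmless for an upper
bound. -/
lemma ShiftUpper.conv [IsProbabilityMeasure μ] [IsProbabilityMeasure ν]
    (hν : ShiftUpper E t ν ν) (hμ : ShiftUpper E t μ κ)
    (hκ : ∀ x, tail κ x ≤ tail (μ.conv ν) x) (hb : ShiftBounded (μ.conv ν)) (ht : 0 ≤ t) :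
    ShiftUpper E t (μ.conv ν) (μ.conv ν) := by
  intro ε hε
  obtain ⟨X, hX⟩ := eventually_atTop.1 (hν (ε / 2) (by simp [hε]))
  obtain ⟨C, hC, hCb⟩ := hb X
  obtain ⟨δ, hδ, -, hδC⟩ := exists_ne_zero_mul_le hC (ENNReal.half_pos hε).ne'
  obtain ⟨x₀, hx₀⟩ := eventually_atTop.1 (hμ δ hδ)
  filter_upwards [eventually_ge_atTop (x₀ + X)] with x hx
  have h1 := tailOn_shift_le (ν := ν) hx₀ (S := Iic X) subset_rfl measurableSet_Iic hx
  have h2 := tailOn_Ioi_shift_le (μ := μ) (ν := ν) (B := X) (t := t) (E := E) (ε := ε / 2)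
    (fun u hu => hX u (by linarith)) x
  have h3 : tailOn μ ν (Ioi (X + t)) x ≤ tailOn μ ν (Ioi X) x :=
    tailOn_mono (Ioi_subset_Ioi (by linarith)) x
  rw [← tailOn_Iic_add_Ioi X (x - t)]
  calc tailOn μ ν (Iic X) (x - t) + tailOn μ ν (Ioi X) (x - t)
      ≤ (E * tailOn μ ν (Iic X) x + δ * (C * tail (μ.conv ν) x)) +
          (E + ε / 2) * tailOn μ ν (Ioi X) x := by
        gcongr
        · exact h1.trans (by gcongr; exact (hκ _).trans (hCb x))
        · exact h2.trans (by gcongr)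
    _ = E * (tailOn μ ν (Iic X) x + tailOn μ ν (Ioi X) x) + δ * C * tail (μ.conv ν) x +
          ε / 2 * tailOn μ ν (Ioi X) x := by ring
    _ ≤ E * tail (μ.conv ν) x + ε / 2 * tail (μ.conv ν) x + ε / 2 * tail (μ.conv ν) x := by
        rw [tailOn_Iic_add_Ioi]
        gcongr
        exact tailOn_le _ _
    _ = E * tail (μ.conv ν) x + ε * tail (μ.conv ν) x := by
        rw [add_assoc, ← add_mul, ENNReal.add_halves]

lemma sum_tailOn_Ioc_le [SFinite μ] [SFinite ν] (ht : 0 ≤ t) (x : ℝ) (N : ℕ) :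
    ∑ j ∈ Finset.range N, tailOn μ ν (Ioc (B + j * t) (B + j * t + t)) x
      ≤ tail (μ.conv ν) x := by
  have key : ∀ N : ℕ, ∑ j ∈ Finset.range N, tailOn μ ν (Ioc (B + j * t) (B + j * t + t)) x
      ≤ tailOn μ ν (Iic (B + N * t)) x := by
    intro N
    induction N with
    | zero => simp
    | succ N ih =>
      rw [Finset.sum_range_succ]
      refine (add_le_add_left ih _).trans ?_
      rw [← tailOn_union measurableSet_Ioc]
      · refine tailOn_mono ?_ x
        push_cast
        rintro y (hy | hy)
        · simp only [mem_Iic] at hy ⊢; nlinarith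
        · have := hy.2
          simp only [mem_Iic]; linarith
      · rw [disjoint_left]
        intro y hy hy'
        exact absurd hy'.1 (not_lt.2 hy)
  exact (key N).trans (tailOn_le _ _)

/-- Lower bound on `P(X + Y > x - t, Y ∉ I)` for a set `I` that is bounded above. -/
lemma le_tailOn_compl_shift [IsProbabilityMeasure μ] [IsProbabilityMeasure ν]
    (hν : ShiftLower E t ν ν) (hμ : ShiftLower E t μ κ)
    (hκ : ∀ x, tail κ x ≤ tail (μ.conv ν) x) (hb : ShiftBounded (μ.conv ν)) (ht : 0 ≤ t)
    (hE : E ≠ ∞) {I : Set ℝ} (hI : MeasurableSet I) {b : ℝ} (hIb : I ⊆ Iic b) {ε : ℝ≥0∞}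
    (hε : ε ≠ 0) :
    ∀ᶠ x in atTop, E * tailOn μ ν Iᶜ x ≤ tailOn μ ν Iᶜ (x - t) + ε * tail (μ.conv ν) x := by
  have hε3 : ε / 3 ≠ 0 := by simp [hε]
  obtain ⟨X, hX⟩ := eventually_atTop.1 (hν (ε / 3) hε3)
  -- Cuts above `X` make the bound for `ν` available; cuts above `b` leave `I` entirely in the lower
  -- part.
  set B := max X b with hB
  obtain ⟨δ₀, hδ₀, -, hδ₀E⟩ := exists_ne_zero_mul_le hE hε3
  -- `N` is the number of windows: averaging the loss over them leaves `E / N ≤ ε / 3`.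
  obtain ⟨N, hN⟩ := ENNReal.exists_inv_nat_lt hδ₀
  have hN0 : (N : ℝ≥0∞) ≠ 0 := by
    rintro h
    simp [h] at hN
  have hNE : E ≤ N * (ε / 3) := by
    calc E = N * ((N : ℝ≥0∞)⁻¹ * E) := by
          rw [← mul_assoc, ENNReal.mul_inv_cancel hN0 (ENNReal.natCast_ne_top N), one_mul]
      _ ≤ N * (δ₀ * E) := by gcongr
      _ ≤ _ := by gcongr
  obtain ⟨C, hC, hCb⟩ := hb (B + N * t)
  obtain ⟨δ, hδ, -, hδC⟩ := exists_ne_zero_mul_le hC hε3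
  obtain ⟨x₀, hx₀⟩ := eventually_atTop.1 (hμ δ hδ)
  filter_upwards [eventually_ge_atTop (x₀ + (B + N * t))] with x hx
  set T := tail (μ.conv ν) x with hT
  have step : ∀ j ∈ Finset.range N, E * tailOn μ ν Iᶜ x ≤ tailOn μ ν Iᶜ (x - t) +
      (ε / 3 + ε / 3) * T + E * tailOn μ ν (Ioc (B + j * t) (B + j * t + t)) x := by
    intro j hj
    have hjN : (j : ℝ) ≤ N := by exact_mod_cast (Finset.mem_range.1 hj).le
    have hjt : 0 ≤ (j : ℝ) * t := by positivity
    have hjt' : (j : ℝ) * t ≤ N * t := by gcongr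
    have hXB : X ≤ B := le_max_left _ _
    have hbB : b ≤ B := le_max_right _ _
    set D := B + j * t with hD
    have h1 := le_tailOn_shift (ν := ν) hx₀ (S := Iic D \ I) (B := B + N * t)
      (sdiff_subset.trans (Iic_subset_Iic.2 (by linarith))) (measurableSet_Iic.diff hI) hx
    have h2 := le_tailOn_Ioi_shift (μ := μ) (ν := ν) (B := D) (t := t) (E := E) (ε := ε / 3)
      (fun u hu => hX u (by linarith)) x
    -- The window `(D, D + t]` is covered by neither shift bound and remains as a loss.
    have hdec : tailOn μ ν Iᶜ x ≤ tailOn μ ν (Iic D \ I) x + tailOn μ ν (Ioi (D + t)) x +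
        tailOn μ ν (Ioc D (D + t)) x := by
      refine (tailOn_mono (T := (Iic D \ I ∪ Ioi (D + t)) ∪ Ioc D (D + t)) ?_ x).trans ?_
      · intro y hy
        by_cases h : y ≤ D
        · exact Or.inl (Or.inl ⟨h, hy⟩)
        by_cases h' : y ≤ D + t
        · exact Or.inr ⟨not_le.1 h, h'⟩
        · exact Or.inl (Or.inr (not_le.1 h'))
      · exact (lintegral_union_le _ _ _).trans (add_le_add_left (lintegral_union_le _ _ _) _)
    have hdec' : tailOn μ ν (Iic D \ I) (x - t) + tailOn μ ν (Ioi D) (x - t) ≤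
        tailOn μ ν Iᶜ (x - t) := by
      rw [← tailOn_union measurableSet_Ioi]
      · refine tailOn_mono ?_ _
        rintro y (hy | hy)
        · exact hy.2
        · intro hyI
          have h3 : y ≤ b := hIb hyI
          have h4 : D < y := hy
          linarith
      · rw [disjoint_left]
        intro y hy hy'
        exact not_lt.2 (mem_Iic.1 hy.1) hy'
    calc E * tailOn μ ν Iᶜ x
        ≤ E * tailOn μ ν (Iic D \ I) x + E * tailOn μ ν (Ioi (D + t)) x +
            E * tailOn μ ν (Ioc D (D + t)) x := by
          rw [← mul_add, ← mul_add]; gcongr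
      _ ≤ (tailOn μ ν (Iic D \ I) (x - t) + δ * (C * T)) +
            (tailOn μ ν (Ioi D) (x - t) + ε / 3 * T) + E * tailOn μ ν (Ioc D (D + t)) x := by
          gcongr
          · exact h1.trans (by gcongr; exact (hκ _).trans (hCb x))
          · exact h2.trans (by gcongr; exact tailOn_le _ _)
      _ = (tailOn μ ν (Iic D \ I) (x - t) + tailOn μ ν (Ioi D) (x - t)) +
            (δ * C + ε / 3) * T + E * tailOn μ ν (Ioc D (D + t)) x := by ring
      _ ≤ _ := by gcongr
  -- The windows are disjoint, so their total mass is at most `T`; summing over `j` and dividing by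
  -- `N` gives the third `ε / 3`.
  have hsum := Finset.sum_le_sum step
  rw [Finset.sum_add_distrib, ← Finset.mul_sum _ (fun j : ℕ => tailOn μ ν (Ioc (B + j * t) (B + j * t + t)) x)] at hsum
  simp only [Finset.sum_const, Finset.card_range, nsmul_eq_mul] at hsum
  have hfin : N * (E * tailOn μ ν Iᶜ x) ≤
      N * (tailOn μ ν Iᶜ (x - t) + (ε / 3 + ε / 3) * T + ε / 3 * T) := by
    rw [mul_add _ _ (ε / 3 * T), ← mul_assoc (N : ℝ≥0∞) (ε / 3)]
    exact hsum.trans (add_le_add le_rfl (mul_le_mul' hNE (sum_tailOn_Ioc_le ht x N)))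
  have := (ENNReal.mul_le_mul_iff_right hN0 (ENNReal.natCast_ne_top N)).1 hfin
  refine this.trans (le_of_eq ?_)
  rw [add_assoc, ← add_mul, ENNReal.add_thirds]

lemma ShiftLower.conv [IsProbabilityMeasure μ] [IsProbabilityMeasure ν]
    (hν : ShiftLower E t ν ν) (hμ : ShiftLower E t μ κ)
    (hκ : ∀ x, tail κ x ≤ tail (μ.conv ν) x) (hb : ShiftBounded (μ.conv ν)) (ht : 0 ≤ t)
    (hE : E ≠ ∞) : ShiftLower E t (μ.conv ν) (μ.conv ν) := by
  intro ε hε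
  have h := le_tailOn_compl_shift hν hμ hκ hb ht hE MeasurableSet.empty (empty_subset (Iic 0)) hε
  simpa [tailOn, ← tail_conv] using h

end Tail

/-! ### Deconvolution: upper bounds for a factor. -/

section Upper

variable {μ ν : Measure ℝ}

/-- On `Y ∈ [a, a + δ]` the sum `X + Y` determines `X` up to `δ`; the price is the shift `s - δ` in
place of `s`. -/
lemma tail_shift_le_of_Icc [IsProbabilityMeasure μ] [IsProbabilityMeasure ν]
    {E : ℝ≥0∞} {s a δ : ℝ} (hν0 : ν (Iio 0) = 0) (hs : 0 ≤ s) (hE : E ≠ ∞)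
    (hν : ShiftLower E s ν ν) (hμ : ShiftLower E s μ μ)
    (hU : ShiftUpper E s (μ.conv ν) (μ.conv ν)) (hb : ShiftBounded (μ.conv ν))
    (hI : ν (Icc a (a + δ)) ≠ 0) {ε : ℝ≥0∞} (hε : ε ≠ 0) :
    ∀ᶠ x in atTop, tail μ (x - (s - δ)) ≤ E * tail μ x + ε * tail (μ.conv ν) x := by
  set I := Icc a (a + δ) with hIdef
  have hIm : MeasurableSet I := measurableSet_Icc
  set c := ν I with hc
  have hc1 : c ≠ ∞ := measure_ne_top _ _
  have haδ : 0 ≤ a + δ := by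
    by_contra! h
    refine hI (measure_mono_null (fun y hy => ?_) hν0)
    exact lt_of_le_of_lt hy.2 h
  obtain ⟨ε', hε', -, hε'c⟩ := exists_ne_zero_mul_le (C := 2) (by simp)
    (show c * ε ≠ 0 from mul_ne_zero hI hε)
  have h1 := le_tailOn_compl_shift hν hμ (fun x => tail_le_tail_conv hν0 x) hb hs hE hIm
    (b := a + δ) (fun y hy => hy.2) hε'
  have h2 := hU ε' hε'
  have h := (tendsto_atTop_add_const_right atTop (a + δ) tendsto_id).eventually (h1.and h2)
  refine h.mono fun x hx => ?_
  simp only [id] at hx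
  obtain ⟨hx1, hx2⟩ := hx
  -- With this `z`, `z - y ≥ x` and `z - s - y ≤ x - (s - δ)` for all `y ∈ I`.
  set z := x + (a + δ) with hz
  rw [← tailOn_add_compl hIm, ← tailOn_add_compl hIm z] at hx2
  rw [← tailOn_add_compl hIm z] at hx1
  set T := tailOn μ ν I z + tailOn μ ν Iᶜ z with hT
  have hTx : T ≤ tail (μ.conv ν) x := by
    rw [hT, tailOn_add_compl hIm]
    exact tail_antitone _ (by linarith)
  have hfin : tailOn μ ν Iᶜ (z - s) ≠ ∞ :=
    ((tailOn_le _ _).trans_lt (tail_ne_top (μ := μ.conv ν) _).lt_top).ne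
  -- The part `Y ∉ I` cancels between the upper bound for the whole and its own lower bound; each
  -- contributes one error `ε'`.
  have h3 : tailOn μ ν I (z - s) ≤ E * tailOn μ ν I z + 2 * ε' * T := by
    refine (ENNReal.add_le_add_iff_right hfin).1 (hx2.trans ?_)
    calc E * T + ε' * T = E * tailOn μ ν I z + E * tailOn μ ν Iᶜ z + ε' * T := by
          rw [hT, mul_add]
      _ ≤ E * tailOn μ ν I z + (tailOn μ ν Iᶜ (z - s) + ε' * T) + ε' * T := by gcongr
      _ = _ := by ring
  have h4 : c * tail μ (x - (s - δ)) ≤ tailOn μ ν I (z - s) := by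
    calc c * tail μ (x - (s - δ)) = ∫⁻ _ in I, tail μ (x - (s - δ)) ∂ν := by simp [c, mul_comm]
      _ ≤ _ := setLIntegral_mono' hIm fun y hy => tail_antitone μ (by
        have := hy.1; simp only [z]; linarith)
  have h5 : tailOn μ ν I z ≤ c * tail μ x := by
    calc tailOn μ ν I z ≤ ∫⁻ _ in I, tail μ x ∂ν :=
          setLIntegral_mono' hIm fun y hy => tail_antitone μ (by
            have := hy.2; simp only [z]; linarith)
      _ = _ := by simp [c, mul_comm]
  refine (ENNReal.mul_le_mul_iff_right hI hc1).1 (h4.trans (h3.trans ?_))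
  calc E * tailOn μ ν I z + 2 * ε' * T
      ≤ E * (c * tail μ x) + (c * ε) * tail (μ.conv ν) x := by
        exact add_le_add (mul_le_mul' le_rfl h5) (mul_le_mul' (by rwa [mul_comm]) hTx)
    _ = _ := by ring

/-- The factor `exp (γ t)` in `ℝ≥0∞`. -/
noncomputable def expFactor (γ t : ℝ) : ℝ≥0∞ := ENNReal.ofReal (Real.exp (γ * t))

lemma expFactor_ne_top (γ t : ℝ) : expFactor γ t ≠ ∞ := ENNReal.ofReal_ne_top

lemma expFactor_ne_zero (γ t : ℝ) : expFactor γ t ≠ 0 := by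
  simp [expFactor, Real.exp_pos]

lemma expFactor_add (γ s t : ℝ) : expFactor γ (s + t) = expFactor γ s * expFactor γ t := by
  rw [expFactor, mul_add, Real.exp_add, ENNReal.ofReal_mul (Real.exp_pos _).le]; rfl

lemma continuous_expFactor (γ : ℝ) : Continuous (expFactor γ) := by
  exact ENNReal.continuous_ofReal.comp (by fun_prop)

/-- Apply the deconvolution bound with `s = t + δ` and let `δ` be small: `exp (γ (t + δ))` is then
close to `exp (γ t)`. The shift `s` must be admissible, whence `δ ∈ H`. -/
lemma shiftUpper_of_shiftLower [IsProbabilityMeasure μ] [IsProbabilityMeasure ν]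
    {H : AddSubgroup ℝ} {γ : ℝ} (hν0 : ν (Iio 0) = 0)
    (hν : ∀ s ∈ H, 0 < s → ShiftLower (expFactor γ s) s ν ν)
    (hμ : ∀ s ∈ H, 0 < s → ShiftLower (expFactor γ s) s μ μ)
    (hU : ∀ s ∈ H, 0 < s → ShiftUpper (expFactor γ s) s (μ.conv ν) (μ.conv ν))
    (hb : ShiftBounded (μ.conv ν))
    (hI : ∀ η : ℝ, 0 < η → ∃ δ ∈ H, 0 ≤ δ ∧ δ < η ∧ ∃ a, ν (Icc a (a + δ)) ≠ 0)
    {t : ℝ} (htH : t ∈ H) (ht : 0 < t) : ShiftUpper (expFactor γ t) t μ (μ.conv ν) := by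
  intro ε hε
  have hε2 : ε / 2 ≠ 0 := by simp [hε]
  have hlim : Tendsto (fun δ => expFactor γ (t + δ)) (𝓝 0) (𝓝 (expFactor γ t)) := by
    have := ((continuous_expFactor γ).comp (continuous_const.add continuous_id)).tendsto
      (x := (0 : ℝ)) (f := fun δ => expFactor γ (t + δ))
    simpa using this
  have hev := hlim.eventually_lt_const
    (ENNReal.lt_add_right (expFactor_ne_top γ t) hε2)
  obtain ⟨η, hη, hball⟩ := Metric.eventually_nhds_iff.1 hev
  obtain ⟨δ, hδH, hδ0, hδη, a, ha⟩ := hI η hη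
  have hEδ := hball (y := δ) (by simpa [abs_of_nonneg hδ0] using hδη)
  have hs : t + δ ∈ H := H.add_mem htH hδH
  have hs0 : 0 < t + δ := by linarith
  have := tail_shift_le_of_Icc hν0 hs0.le (expFactor_ne_top _ _) (hν _ hs hs0) (hμ _ hs hs0)
    (hU _ hs hs0) hb ha hε2
  refine this.mono fun x hx => ?_
  rw [add_sub_cancel_right] at hx
  calc tail μ (x - t) ≤ _ := hx
    _ ≤ (expFactor γ t + ε / 2) * tail μ x + ε / 2 * tail (μ.conv ν) x := by gcongr
    _ ≤ expFactor γ t * tail μ x + (ε / 2 * tail (μ.conv ν) x +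
          ε / 2 * tail (μ.conv ν) x) := by
        rw [add_mul, add_assoc]
        gcongr
        exact tail_le_tail_conv hν0 x
    _ = _ := by rw [← add_mul, ENNReal.add_halves]

end Upper

/-! ### Shift bounds for convolution powers. -/

section ConvPow

variable {F : Measure ℝ}

lemma convPow_zero : convPow F 0 = Measure.dirac 0 := rfl

lemma convPow_succ (k : ℕ) : convPow F (k + 1) = (convPow F k).conv F := rfl

lemma tail_convPow_zero {x : ℝ} (hx : 0 ≤ x) : tail (convPow F 0) x = 0 := by
  rw [convPow_zero, tail, Measure.dirac_apply' _ measurableSet_Ioi]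
  simp [hx]

lemma shiftUpper_convPow_zero (E : ℝ≥0∞) (t : ℝ) (κ : Measure ℝ) :
    ShiftUpper E t (convPow F 0) κ := fun ε _ => by
  filter_upwards [eventually_ge_atTop t] with x hx
  rw [tail_convPow_zero (by linarith)]
  exact zero_le

lemma shiftLower_convPow_zero (E : ℝ≥0∞) (t : ℝ) (κ : Measure ℝ) :
    ShiftLower E t (convPow F 0) κ := fun ε _ => by
  filter_upwards [eventually_ge_atTop 0] with x hx
  rw [tail_convPow_zero hx, mul_zero]
  exact zero_le

variable [IsProbabilityMeasure F]

instance isProbabilityMeasure_convPow (k : ℕ) : IsProbabilityMeasure (convPow F k) := by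
  induction k with
  | zero => exact inferInstanceAs (IsProbabilityMeasure (Measure.dirac 0))
  | succ k ih => exact inferInstanceAs (IsProbabilityMeasure ((convPow F k).conv F))

lemma convPow_one : convPow F 1 = F := by
  rw [convPow_succ, convPow_zero, Measure.dirac_zero_conv]

lemma convPow_add (i j : ℕ) : convPow F (i + j) = (convPow F i).conv (convPow F j) := by
  induction j with
  | zero => rw [convPow_zero, Measure.conv_dirac_zero, add_zero]
  | succ j ih => rw [← add_assoc, convPow_succ, ih, convPow_succ, Measure.conv_assoc]

lemma convPow_mul (i j : ℕ) : convPow F (i * j) = convPow (convPow F i) j := by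
  induction j with
  | zero => rfl
  | succ j ih => rw [Nat.mul_succ, convPow_add, ih, convPow_succ]

lemma ae_conv {μ ν : Measure ℝ} [SFinite μ] [SFinite ν] {p q r : ℝ → Prop}
    (hp : ∀ᵐ x ∂μ, p x) (hq : ∀ᵐ y ∂ν, q y) (h : ∀ x y, p x → q y → r (x + y))
    (hr : MeasurableSet {z | r z}) : ∀ᵐ z ∂(μ.conv ν), r z := by
  rw [Measure.conv, ae_map_iff (by fun_prop) hr]
  filter_upwards [Measure.quasiMeasurePreserving_fst.ae hp,
    Measure.quasiMeasurePreserving_snd.ae hq] with z h1 h2 using h _ _ h1 h2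

lemma ae_nonneg_iff {μ : Measure ℝ} : (∀ᵐ y ∂μ, 0 ≤ y) ↔ μ (Iio 0) = 0 := by
  rw [ae_iff]; simp [Iio]

lemma ae_dirac_zero {p : ℝ → Prop} (h : p 0) : ∀ᵐ x ∂(Measure.dirac (0 : ℝ)), p x := by
  rw [ae_dirac_eq]; exact h

lemma convPow_Iio (hF : F (Iio 0) = 0) (k : ℕ) : convPow F k (Iio 0) = 0 := by
  rw [← ae_nonneg_iff] at hF ⊢
  induction k with
  | zero => exact ae_dirac_zero le_rfl
  | succ k ih => exact ae_conv ih hF (fun _ _ => add_nonneg) measurableSet_Ici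

lemma convPow_mem (H : AddSubgroup ℝ) (hH : MeasurableSet (H : Set ℝ))
    (hF : ∀ᵐ y ∂F, y ∈ H) (k : ℕ) : ∀ᵐ y ∂(convPow F k), y ∈ H := by
  induction k with
  | zero => exact ae_dirac_zero H.zero_mem
  | succ k ih => exact ae_conv ih hF (fun _ _ => H.add_mem) hH

lemma tail_convPow_mono (hF : F (Iio 0) = 0) (x : ℝ) :
    Monotone fun k => tail (convPow F k) x :=
  monotone_nat_of_le_succ fun k => by rw [convPow_succ]; exact tail_le_tail_conv hF x

variable {n : ℕ} {E : ℝ≥0∞} {t : ℝ}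

/-- Induction removing one factor `F^{*n}` at a time. The remaining power may be below `n`, hence
the `max`. -/
lemma shiftUpper_convPow (hF : F (Iio 0) = 0) (hn : 1 ≤ n) (ht : 0 ≤ t)
    (hb : ShiftBounded (convPow F n)) (hUn : ShiftUpper E t (convPow F n) (convPow F n))
    (hU : ∀ i < n, ShiftUpper E t (convPow F i) (convPow F n)) (k : ℕ) :
    ShiftUpper E t (convPow F k) (convPow F (max k n)) := by
  induction k using Nat.strong_induction_on with
  | _ k ih =>
  rcases lt_or_ge k n with hk | hk
  · rw [max_eq_right hk.le]; exact hU k hk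
  · rw [max_eq_left hk]
    obtain ⟨j, rfl⟩ := Nat.exists_eq_add_of_le' hk
    rw [convPow_add]
    refine hUn.conv (ih j (by omega)) (fun x => ?_) hb.conv ht
    rw [← convPow_add]
    exact tail_convPow_mono hF x (by omega)

lemma shiftLower_convPow (hF : F (Iio 0) = 0) (hn : 1 ≤ n) (ht : 0 ≤ t) (hE : E ≠ ∞)
    (hb : ShiftBounded (convPow F n)) (hLn : ShiftLower E t (convPow F n) (convPow F n))
    (hL : ∀ i < n, ShiftLower E t (convPow F i) (convPow F n)) (k : ℕ) :
    ShiftLower E t (convPow F k) (convPow F (max k n)) := by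
  induction k using Nat.strong_induction_on with
  | _ k ih =>
  rcases lt_or_ge k n with hk | hk
  · rw [max_eq_right hk.le]; exact hL k hk
  · rw [max_eq_left hk]
    obtain ⟨j, rfl⟩ := Nat.exists_eq_add_of_le' hk
    rw [convPow_add]
    refine hLn.conv (ih j (by omega)) (fun x => ?_) hb.conv ht hE
    rw [← convPow_add]
    exact tail_convPow_mono hF x (by omega)

/-- For `k ≥ n`, a shift bound for `F^{*n}` far out gives one for `F^{*k}`, uniformly in `k`, up to
the tail of `F^{*(k-1)}`. -/
lemma tail_convPow_shift_le (hF : F (Iio 0) = 0) (hn : 1 ≤ n) {ε : ℝ≥0∞} {B : ℝ}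
    (h : ∀ u, B + t ≤ u →
      tail (convPow F n) (u - t) ≤ E * tail (convPow F n) u + ε * tail (convPow F n) u)
    {k : ℕ} (hk : n ≤ k) (x : ℝ) :
    tail (convPow F k) (x - t) ≤
      (E + ε) * tail (convPow F k) x + tail (convPow F (k - 1)) (x - (t + B)) := by
  obtain ⟨j, rfl⟩ := Nat.exists_eq_add_of_le' hk
  have h1 := tailOn_Ioi_shift_le (μ := convPow F j) h x
  -- If the factor `F^{*n}` is at most `B`, the other one, a power of order `k - n ≤ k - 1`, exceeds
  -- `x - t - B`.
  have h2 : tailOn (convPow F j) (convPow F n) (Iic B) (x - t) ≤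
      tail (convPow F (j + n - 1)) (x - (t + B)) := by
    refine (setLIntegral_tail_sub_le subset_rfl measurableSet_Iic _).trans ?_
    rw [sub_sub]
    exact tail_convPow_mono hF _ (by omega)
  rw [convPow_add, ← tailOn_Iic_add_Ioi B (x - t), add_comm]
  exact add_le_add (h1.trans (by gcongr; exact tailOn_le _ _)) h2

lemma le_tail_convPow_shift (hF : F (Iio 0) = 0) (hn : 1 ≤ n) {ε : ℝ≥0∞} {B : ℝ}
    (h : ∀ u, B + t ≤ u →
      E * tail (convPow F n) u ≤ tail (convPow F n) (u - t) + ε * tail (convPow F n) u)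
    {k : ℕ} (hk : n ≤ k) (x : ℝ) :
    E * tail (convPow F k) x ≤ tail (convPow F k) (x - t) + ε * tail (convPow F k) x +
      E * tail (convPow F (k - 1)) (x - (t + B)) := by
  obtain ⟨j, rfl⟩ := Nat.exists_eq_add_of_le' hk
  have h1 := le_tailOn_Ioi_shift (μ := convPow F j) h x
  have h2 : tailOn (convPow F j) (convPow F n) (Iic (B + t)) x ≤
      tail (convPow F (j + n - 1)) (x - (t + B)) := by
    refine (setLIntegral_tail_sub_le subset_rfl measurableSet_Iic _).trans ?_
    rw [add_comm B]
    exact tail_convPow_mono hF _ (by omega)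
  rw [convPow_add]
  nth_rewrite 1 [← tailOn_Iic_add_Ioi (B + t) x]
  rw [mul_add, add_comm]
  refine add_le_add (h1.trans ?_) (by gcongr)
  gcongr <;> exact tailOn_le _ _

end ConvPow

/-! ### Passing to the mixture. -/

section Mixture

variable {F : Measure ℝ} {p : ℕ → ℝ≥0∞} {n : ℕ}

/-- The mixture of the convolution powers of `F` with weights `p`. -/
noncomputable def mixture (p : ℕ → ℝ≥0∞) (F : Measure ℝ) : Measure ℝ :=
  Measure.sum fun k => p k • convPow F k

lemma tail_mixture (x : ℝ) : tail (mixture p F) x = ∑' k, p k * tail (convPow F k) x := by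
  rw [tail, mixture, Measure.sum_apply _ measurableSet_Ioi]
  rfl

lemma mul_tail_le_tail_mixture (k : ℕ) (x : ℝ) :
    p k * tail (convPow F k) x ≤ tail (mixture p F) x := by
  rw [tail_mixture]
  exact ENNReal.le_tsum (f := fun k => p k * tail (convPow F k) x) k

lemma mixture_le_one [IsProbabilityMeasure F] (hp : ∑' k, p k ≤ 1) (s : Set ℝ)
    (hs : MeasurableSet s) : mixture p F s ≤ 1 := by
  rw [mixture, Measure.sum_apply _ hs]
  refine le_trans (ENNReal.tsum_le_tsum fun k => ?_) hp
  exact mul_le_of_le_one_right' prob_le_one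

lemma exists_tail_convPow_le_mixture [IsProbabilityMeasure F] (hF : F (Iio 0) = 0)
    {k : ℕ} (hnk : n ≤ k) (hk : p k ≠ 0) :
    ∃ A : ℝ≥0∞, A ≠ ∞ ∧ ∀ x, tail (convPow F n) x ≤ A * tail (mixture p F) x := by
  obtain ⟨c, hc0, hck⟩ : ∃ c : ℝ≥0∞, c ≠ 0 ∧ (c ≤ p k ∧ c ≠ ∞) :=
    -- Capped at `1` because the weight is not assumed finite.
    ⟨min (p k) 1, by simp [hk], min_le_left _ _, by simp⟩
  refine ⟨c⁻¹, by simpa using hc0, fun x => ?_⟩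
  calc tail (convPow F n) x = c⁻¹ * (c * tail (convPow F n) x) := by
        rw [← mul_assoc, ENNReal.inv_mul_cancel hc0 hck.2, one_mul]
    _ ≤ c⁻¹ * (p k * tail (convPow F k) x) := by
        gcongr
        · exact hck.1
        · exact tail_convPow_mono hF x hnk
    _ ≤ _ := by gcongr; exact mul_tail_le_tail_mixture k x

/-- A tail-sum condition: the part of `∑ k, p k * tail F^{*(k-1)} x` from some `K` on is a small
multiple of the tail of the mixture, uniformly in `x ≥ 0`. -/
def MixtureTailSumCond (p : ℕ → ℝ≥0∞) (F : Measure ℝ) : Prop :=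
  ∀ ε : ℝ≥0∞, ε ≠ 0 → ∃ K : ℕ, ∀ x : ℝ, 0 ≤ x →
    ∑' k, p k * (if K ≤ k then tail (convPow F (k - 1)) x else 0) ≤ ε * tail (mixture p F) x

variable [IsProbabilityMeasure F] (hF : F (Iio 0) = 0) (hn : 1 ≤ n) (hp : ∑' k, p k ≤ 1)
  {A : ℝ≥0∞} (hA : A ≠ ∞) (hAn : ∀ x, tail (convPow F n) x ≤ A * tail (mixture p F) x)
  (hb : ShiftBounded (convPow F n))

include hF hp hA hAn hb

/-- Powers from `n` on share the constant of `F^{*n}`; lower ones are dominated by `F^{*n}`, hence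
by `A` times the mixture. -/
lemma shiftBounded_mixture : ShiftBounded (mixture p F) := by
  intro B
  obtain ⟨C, hC, h⟩ := hb B
  refine ⟨C + C * A, by finiteness, fun x => ?_⟩
  have hk (k : ℕ) : tail (convPow F k) (x - B) ≤
      C * tail (convPow F k) x + C * tail (convPow F n) x := by
    rcases le_total n k with hk | hk
    · obtain ⟨j, rfl⟩ := Nat.exists_eq_add_of_le' hk
      rw [convPow_add]
      exact (tail_conv_shift_le h x).trans le_self_add
    · exact ((tail_convPow_mono hF _ hk).trans (h x)).trans le_add_self
  calc tail (mixture p F) (x - B)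
      ≤ ∑' k, (C * (p k * tail (convPow F k) x) + p k * (C * tail (convPow F n) x)) := by
        rw [tail_mixture]
        refine ENNReal.tsum_le_tsum fun k => ?_
        refine (mul_le_mul' le_rfl (hk k)).trans (le_of_eq ?_)
        ring
    _ = C * tail (mixture p F) x + (∑' k, p k) * (C * tail (convPow F n) x) := by
        rw [ENNReal.tsum_add, ENNReal.tsum_mul_left, ENNReal.tsum_mul_right, tail_mixture]
    _ ≤ C * tail (mixture p F) x + 1 * (C * (A * tail (mixture p F) x)) := by
        gcongr
        exact hAn x
    _ = _ := by ring

include hn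

variable {E : ℝ≥0∞} {t : ℝ}

lemma shiftUpper_mixture (ht : 0 ≤ t) (hts : MixtureTailSumCond p F)
    (hU : ∀ k, ShiftUpper E t (convPow F k) (convPow F (max k n))) :
    ShiftUpper E t (mixture p F) (mixture p F) := by
  intro ε hε
  -- In `1 + A + 1` the terms stand for the error relative to `F^{*k}`, the one relative to
  -- `F^{*n}`, and the tail sum.
  obtain ⟨δ, hδ, -, hδε⟩ := exists_ne_zero_mul_le (C := 1 + A + 1) (by finiteness) hε
  have hUn := hU n
  rw [max_self] at hUn
  obtain ⟨B, hB⟩ := eventually_atTop.1 (hUn δ hδ)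
  obtain ⟨C, hC, hCb⟩ := shiftBounded_mixture hF hp hA hAn hb (t + B)
  obtain ⟨δ', hδ', -, hδ'C⟩ := exists_ne_zero_mul_le hC hδ
  obtain ⟨K, hK⟩ := hts δ' hδ'
  have hfin : ∀ᶠ x in atTop, ∀ k ∈ Finset.range (max K n), tail (convPow F k) (x - t) ≤
      E * tail (convPow F k) x + δ * tail (convPow F (max k n)) x :=
    (Filter.eventually_all_finset _).2 fun k _ => hU k δ hδ
  filter_upwards [hfin, eventually_ge_atTop (t + B)] with x hx hxB
  set R := tail (mixture p F) x with hR
  have hk (k : ℕ) : tail (convPow F k) (x - t) ≤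
      (E + δ) * tail (convPow F k) x + δ * tail (convPow F n) x +
        (if K ≤ k then tail (convPow F (k - 1)) (x - (t + B)) else 0) := by
    rcases lt_or_ge k (max K n) with hk | hk
    · refine (hx k (Finset.mem_range.2 hk)).trans (le_trans ?_ le_self_add)
      rw [add_mul, add_assoc, ← mul_add]
      gcongr
      rcases le_total k n with h | h
      · rw [max_eq_right h]; exact le_add_self
      · rw [max_eq_left h]; exact le_self_add
    · rw [if_pos ((le_max_left _ _).trans hk)]
      refine (tail_convPow_shift_le hF hn (B := B) (fun u hu => hB u (by linarith))
        ((le_max_right _ _).trans hk) x).trans ?_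
      gcongr
      exact le_self_add
  calc tail (mixture p F) (x - t)
      ≤ ∑' k, ((E + δ) * (p k * tail (convPow F k) x) + p k * (δ * tail (convPow F n) x) +
          p k * (if K ≤ k then tail (convPow F (k - 1)) (x - (t + B)) else 0)) := by
        rw [tail_mixture]
        refine ENNReal.tsum_le_tsum fun k => ?_
        refine (mul_le_mul' le_rfl (hk k)).trans (le_of_eq ?_)
        ring
    _ = (E + δ) * R + (∑' k, p k) * (δ * tail (convPow F n) x) +
          ∑' k, p k * (if K ≤ k then tail (convPow F (k - 1)) (x - (t + B)) else 0) := by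
        rw [ENNReal.tsum_add, ENNReal.tsum_add, ENNReal.tsum_mul_left, ENNReal.tsum_mul_right, hR,
          tail_mixture]
    _ ≤ (E + δ) * R + 1 * (δ * (A * R)) + δ' * (C * R) := by
        gcongr
        · exact hAn x
        · exact (hK _ (by linarith)).trans (by gcongr; exact hCb x)
    _ = E * R + δ * R + δ * A * R + δ' * C * R := by ring
    _ ≤ E * R + δ * R + δ * A * R + δ * R := by gcongr
    _ = E * R + δ * (1 + A + 1) * R := by ring
    _ ≤ _ := by gcongr

lemma shiftLower_mixture (ht : 0 ≤ t) (hE : E ≠ ∞) (hts : MixtureTailSumCond p F)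
    (hL : ∀ k, ShiftLower E t (convPow F k) (convPow F (max k n))) :
    ShiftLower E t (mixture p F) (mixture p F) := by
  intro ε hε
  obtain ⟨δ, hδ, -, hδε⟩ := exists_ne_zero_mul_le (C := 1 + A + 1) (by finiteness) hε
  have hLn := hL n
  rw [max_self] at hLn
  obtain ⟨B, hB⟩ := eventually_atTop.1 (hLn δ hδ)
  obtain ⟨C, hC, hCb⟩ := shiftBounded_mixture hF hp hA hAn hb (t + B)
  obtain ⟨δ', hδ', -, hδ'C⟩ := exists_ne_zero_mul_le (C := E * C) (by finiteness) hδ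
  obtain ⟨K, hK⟩ := hts δ' hδ'
  have hfin : ∀ᶠ x in atTop, ∀ k ∈ Finset.range (max K n), E * tail (convPow F k) x ≤
      tail (convPow F k) (x - t) + δ * tail (convPow F (max k n)) x :=
    (Filter.eventually_all_finset _).2 fun k _ => hL k δ hδ
  filter_upwards [hfin, eventually_ge_atTop (t + B)] with x hx hxB
  set R := tail (mixture p F) x with hR
  have hk (k : ℕ) : E * tail (convPow F k) x ≤
      tail (convPow F k) (x - t) + δ * tail (convPow F k) x + δ * tail (convPow F n) x +
        E * (if K ≤ k then tail (convPow F (k - 1)) (x - (t + B)) else 0) := by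
    rcases lt_or_ge k (max K n) with hk | hk
    · refine (hx k (Finset.mem_range.2 hk)).trans (le_trans ?_ le_self_add)
      rw [add_assoc, ← mul_add]
      gcongr
      rcases le_total k n with h | h
      · rw [max_eq_right h]; exact le_add_self
      · rw [max_eq_left h]; exact le_self_add
    · rw [if_pos ((le_max_left _ _).trans hk)]
      refine (le_tail_convPow_shift hF hn (B := B) (fun u hu => hB u (by linarith))
        ((le_max_right _ _).trans hk) x).trans ?_
      exact add_le_add le_self_add le_rfl
  calc E * R
      ≤ ∑' k, (p k * tail (convPow F k) (x - t) + δ * (p k * tail (convPow F k) x) +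
          p k * (δ * tail (convPow F n) x) +
          E * (p k * (if K ≤ k then tail (convPow F (k - 1)) (x - (t + B)) else 0))) := by
        rw [hR, tail_mixture, ← ENNReal.tsum_mul_left]
        refine ENNReal.tsum_le_tsum fun k => ?_
        rw [mul_left_comm]
        refine (mul_le_mul' le_rfl (hk k)).trans (le_of_eq ?_)
        ring
    _ = tail (mixture p F) (x - t) + δ * R + (∑' k, p k) * (δ * tail (convPow F n) x) +
          E * ∑' k, p k * (if K ≤ k then tail (convPow F (k - 1)) (x - (t + B)) else 0) := by
        rw [ENNReal.tsum_add, ENNReal.tsum_add, ENNReal.tsum_add, ENNReal.tsum_mul_left,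
          ENNReal.tsum_mul_left, ENNReal.tsum_mul_right, hR, tail_mixture, tail_mixture]
    _ ≤ tail (mixture p F) (x - t) + δ * R + 1 * (δ * (A * R)) + E * (δ' * (C * R)) := by
        gcongr
        · exact hAn x
        · exact (hK _ (by linarith)).trans (by gcongr; exact hCb x)
    _ = tail (mixture p F) (x - t) + (δ * R + δ * A * R + δ' * (E * C) * R) := by ring
    _ ≤ tail (mixture p F) (x - t) + (δ * R + δ * A * R + δ * R) := by gcongr
    _ = tail (mixture p F) (x - t) + δ * (1 + A + 1) * R := by ring
    _ ≤ _ := by gcongr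

end Mixture

/-! ### The law of the random index. -/

section RandomConv

variable {Ω : Type*} [MeasurableSpace Ω] {P : Measure Ω} {τ : Ω → ℕ} {F : Measure ℝ}

lemma randomConv_eq_mixture : randomConv P τ F = mixture (prob P τ) F := rfl

lemma tsum_prob [IsProbabilityMeasure P] (hτ : Measurable τ) : ∑' k, prob P τ k = 1 := by
  unfold prob
  rw [← measure_iUnion]
  · rw [← measure_univ (μ := P)]
    congr 1
    ext ω
    simp
  · intro i j hij
    rw [Function.onFun, disjoint_left]
    rintro ω rfl h
    exact hij h
  · exact fun k => hτ (measurableSet_singleton k)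

lemma exists_prob_ne_zero {m : ℕ} (h : 0 < P {ω | m ≤ τ ω}) : ∃ k, m ≤ k ∧ prob P τ k ≠ 0 := by
  by_contra! hk
  refine h.ne' (measure_mono_null (t := ⋃ k : {k // m ≤ k}, {ω | τ ω = k}) ?_ ?_)
  · intro ω hω
    simpa using hω
  · exact measure_iUnion_null fun k => hk k k.2

lemma TailSumCond.mixtureTailSumCond (h : TailSumCond P τ F) :
    MixtureTailSumCond (prob P τ) F := by
  intro ε hε
  obtain ⟨r, hr0, hr⟩ := ENNReal.lt_iff_exists_nnreal_btwn.1
    (show 0 < min ε 1 from lt_min hε.bot_lt one_pos)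
  have hr1 : (r : ℝ≥0∞) < 1 := hr.trans_le (min_le_right _ _)
  obtain ⟨M, hM⟩ := h r (by exact_mod_cast hr0) (by exact_mod_cast hr1)
  -- Starting at `M + 1` accounts for the index shift and excludes `k = 0`, where `k - 1` is
  -- truncated.
  refine ⟨M + 1, fun x hx => ?_⟩
  rw [tsum_eq_zero_add' ENNReal.summable]
  simp only [nonpos_iff_eq_zero, Nat.add_eq_zero_iff, one_ne_zero, and_false, if_false, mul_zero,
    zero_add, Nat.add_le_add_iff_right, Nat.add_sub_cancel]
  refine le_trans (le_of_eq ?_) ((hM x hx).trans ?_)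
  · rw [show (∑' k : {k : ℕ // M ≤ k}, prob P τ (k + 1) * tail (convPow F k) x) = _ from
      tsum_subtype {k : ℕ | M ≤ k} (fun k => prob P τ (k + 1) * tail (convPow F k) x)]
    refine tsum_congr fun k => ?_
    by_cases hk : M ≤ k <;> simp [hk]
  · rw [ENNReal.ofReal_coe_nnreal]
    gcongr
    · exact (hr.trans_le (min_le_left _ _)).le
    · exact le_rfl

end RandomConv

/-! ### Admissible arguments and the class `L(γ)`. -/

section ArgSet

variable {μ : Measure ℝ} {γ d t : ℝ}

lemma IsLatticeWithSpan.unique {d' : ℝ} (h : IsLatticeWithSpan μ d)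
    (h' : IsLatticeWithSpan μ d') : d = d' := by
  rcases lt_trichotomy d d' with hlt | heq | hlt
  · exact absurd h'.2.1 (h.2.2 d' hlt)
  · exact heq
  · exact absurd h.2.1 (h'.2.2 d hlt)

lemma argSet_eq_zmultiples (hγ : 0 < γ) (h : IsLatticeWithSpan μ d) :
    argSet γ μ = AddSubgroup.zmultiples d := by
  ext t
  exact ⟨fun ht => ht hγ d h, fun ht _ d' h' => h.unique h' ▸ ht⟩

lemma argSet_eq_univ (h : 0 < γ → ∀ d, ¬ IsLatticeWithSpan μ d) : argSet γ μ = univ :=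
  eq_univ_of_forall fun _ hγ d hd => absurd hd (h hγ d)

lemma measurableSet_zmultiples (d : ℝ) :
    MeasurableSet (AddSubgroup.zmultiples d : Set ℝ) :=
  (countable_range fun m : ℤ => m • d).measurableSet

/-- The admissible values form either the whole line or the lattice generated by the span. -/
lemma argSet_cases (γ : ℝ) (μ : Measure ℝ) :
    argSet γ μ = univ ∨
      0 < γ ∧ ∃ d, IsLatticeWithSpan μ d ∧ argSet γ μ = AddSubgroup.zmultiples d := by
  by_cases h : 0 < γ ∧ ∃ d, IsLatticeWithSpan μ d
  · obtain ⟨hγ, d, hd⟩ := h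
    exact Or.inr ⟨hγ, d, hd, argSet_eq_zmultiples hγ hd⟩
  · push Not at h
    exact Or.inl (argSet_eq_univ h)

lemma tail_floor (hd : 0 < d) (h : μ ((AddSubgroup.zmultiples d : Set ℝ)ᶜ) = 0) (x : ℝ) :
    tail μ x = tail μ (⌊x / d⌋ * d) := by
  refine measure_congr ?_
  have hae : ∀ᵐ y ∂μ, y ∈ AddSubgroup.zmultiples d := by rwa [ae_iff]
  filter_upwards [hae] with y hy
  obtain ⟨m, rfl⟩ := AddSubgroup.mem_zmultiples_iff.1 hy
  refine propext (?_ : x < m • d ↔ ⌊x / d⌋ * d < m • d)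
  rw [zsmul_eq_mul, ← div_lt_iff₀ hd, mul_lt_mul_iff_left₀ hd, Int.cast_lt, Int.floor_lt]

/-- Statements on the tail at `x - t` and `x` that hold for large admissible `x` hold for all large
real `x`. -/
lemma eventually_atTop_of_argTop {q : ℝ≥0∞ → ℝ≥0∞ → Prop} (ht : t ∈ argSet γ μ)
    (h : ∀ᶠ x in argTop γ μ, q (tail μ (x - t)) (tail μ x)) :
    ∀ᶠ x in atTop, q (tail μ (x - t)) (tail μ x) := by
  rcases argSet_cases γ μ with hu | ⟨-, d, ⟨hd, hμ, -⟩, hS⟩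
  · simpa [argTop, hu] using h
  · rw [argTop, eventually_inf_principal, hS] at h
    obtain ⟨X, hX⟩ := eventually_atTop.1 h
    rw [hS] at ht
    obtain ⟨m, rfl⟩ := AddSubgroup.mem_zmultiples_iff.1 ht
    filter_upwards [eventually_ge_atTop (X + d)] with x hx
    have h1 : x / d < ⌊x / d⌋ + 1 := Int.lt_floor_add_one _
    rw [div_lt_iff₀ hd] at h1
    have := hX (⌊x / d⌋ * d) (by linarith)
      (AddSubgroup.mem_zmultiples_iff.2 ⟨⌊x / d⌋, zsmul_eq_mul _ _⟩)
    rw [← tail_floor hd hμ x] at this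
    rw [tail_floor hd hμ (x - m • d)]
    have hfl : ⌊(x - m • d) / d⌋ = ⌊x / d⌋ - m := by
      rw [sub_div, zsmul_eq_mul, mul_div_cancel_right₀ _ hd.ne', Int.floor_sub_intCast]
    rw [hfl]
    push_cast
    rwa [sub_mul, ← zsmul_eq_mul _ m]

/-- A lattice tail is a step function, so `x` may run through all reals; only `t` stays restricted.
-/
lemma ClassL.tendsto (h : ClassL γ μ) (ht : t ∈ argSet γ μ) :
    Tendsto (fun x => tail μ (x - t) / tail μ x) atTop (𝓝 (expFactor γ t)) := fun _ hU =>
  eventually_atTop_of_argTop (q := fun a b => a / b ∈ _) ht (h t ht hU)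

lemma zero_mem_argSet : (0 : ℝ) ∈ argSet γ μ := fun _ _ _ => zero_mem _

lemma ClassL.tail_ne_zero (h : ClassL γ μ) (x : ℝ) : tail μ x ≠ 0 := by
  have h0 := h.tendsto zero_mem_argSet
  have h1 := h0.eventually_ne (expFactor_ne_zero γ 0)
  obtain ⟨y, hy, hxy⟩ := (h1.and (eventually_ge_atTop x)).exists
  intro hx
  refine hy ?_
  -- If the tail vanished at `x`, the ratio at `y ≥ x` would be `0 / 0 = 0`.
  rw [sub_zero, le_antisymm ((tail_antitone μ hxy).trans hx.le) zero_le]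
  simp

lemma shiftLower_of_eventually [IsProbabilityMeasure μ] {E : ℝ≥0∞} (hE : E ≠ ∞)
    (hpos : ∀ x, tail μ x ≠ 0)
    (h : ∀ c < E, ∀ᶠ x in atTop, c < tail μ (x - t) / tail μ x) : ShiftLower E t μ μ := by
  intro ε hε
  rcases eq_or_ne E 0 with rfl | hE0
  · simp
  refine (h (E - ε) (ENNReal.sub_lt_self hE hE0 hε)).mono fun x hx => ?_
  calc E * tail μ x ≤ (E - ε + ε) * tail μ x := by gcongr; exact le_tsub_add
    _ ≤ (tail μ (x - t) / tail μ x + ε) * tail μ x := by gcongr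
    _ = _ := by rw [add_mul, ENNReal.div_mul_cancel (hpos x) (tail_ne_top x)]

lemma ClassL.shiftLower [IsProbabilityMeasure μ] (h : ClassL γ μ) (ht : t ∈ argSet γ μ) :
    ShiftLower (expFactor γ t) t μ μ :=
  shiftLower_of_eventually (expFactor_ne_top γ t) h.tail_ne_zero
    fun _ hc => (h.tendsto ht).eventually_const_lt hc

lemma LiminfCond.shiftLower [IsProbabilityMeasure μ] (h : LiminfCond γ μ)
    (hpos : ∀ x, tail μ x ≠ 0) (ht : t ∈ argSet γ μ) (ht0 : 0 < t) :
    ShiftLower (expFactor γ t) t μ μ :=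
  shiftLower_of_eventually (expFactor_ne_top γ t) hpos fun c hc =>
    eventually_atTop_of_argTop (q := fun a b => c < a / b) ht
      (eventually_lt_of_lt_liminf (hc.trans_le (h t ht ht0)))

lemma ClassL.shiftUpper [IsProbabilityMeasure μ] (h : ClassL γ μ) (ht : t ∈ argSet γ μ) :
    ShiftUpper (expFactor γ t) t μ μ := by
  intro ε hε
  refine ((h.tendsto ht).eventually_lt_const
    (ENNReal.lt_add_right (expFactor_ne_top γ t) hε)).mono fun x hx => ?_
  rw [← add_mul]
  exact (ENNReal.div_le_iff (h.tail_ne_zero x) (tail_ne_top x)).1 hx.le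

lemma exists_argSet_ge (γ : ℝ) (μ : Measure ℝ) (B : ℝ) : ∃ t ∈ argSet γ μ, B ≤ t := by
  rcases argSet_cases γ μ with hu | ⟨-, d, ⟨hd, -, -⟩, hS⟩
  · exact ⟨B, hu ▸ mem_univ B, le_rfl⟩
  · refine ⟨⌈B / d⌉ * d, ?_, ?_⟩
    · rw [hS]
      exact AddSubgroup.mem_zmultiples_iff.2 ⟨⌈B / d⌉, zsmul_eq_mul _ _⟩
    · rw [← div_le_iff₀ hd]
      exact Int.le_ceil _

lemma ClassL.shiftBounded [IsProbabilityMeasure μ] (h : ClassL γ μ) : ShiftBounded μ := by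
  intro B
  obtain ⟨t, ht, hBt⟩ := exists_argSet_ge γ μ B
  obtain ⟨X, hX⟩ := eventually_atTop.1 (h.shiftUpper ht 1 one_ne_zero)
  -- The last summand covers `x ≤ X`, the others `x ≥ X`.
  refine ⟨expFactor γ t + 1 + (tail μ X)⁻¹, ?_, fun x => ?_⟩
  · have := expFactor_ne_top γ t
    have := h.tail_ne_zero X
    finiteness
  · rw [add_mul]
    rcases le_total X x with hx | hx
    · refine le_trans ?_ le_self_add
      rw [add_mul]
      exact (tail_antitone μ (by linarith)).trans (hX x hx)
    · refine le_trans ?_ le_add_self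
      calc tail μ (x - B) ≤ 1 := tail_le_one _
        _ = (tail μ X)⁻¹ * tail μ X :=
          (ENNReal.inv_mul_cancel (h.tail_ne_zero X) (tail_ne_top X)).symm
        _ ≤ _ := by gcongr; exact tail_antitone μ hx

lemma tendsto_of_shift {E : ℝ≥0∞} (hE : E ≠ ∞) (hpos : ∀ x, tail μ x ≠ 0)
    (hfin : ∀ x, tail μ x ≠ ∞) (hU : ShiftUpper E t μ μ) (hL : ShiftLower E t μ μ) :
    Tendsto (fun x => tail μ (x - t) / tail μ x) atTop (𝓝 E) := by
  refine (ENNReal.tendsto_nhds hE).2 fun ε hε => ?_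
  filter_upwards [hU ε hε.ne', hL ε hε.ne'] with x hxU hxL
  refine ⟨tsub_le_iff_right.2 ?_, ?_⟩
  · refine (ENNReal.mul_le_mul_iff_left (hpos x) (hfin x)).1 ?_
    rwa [add_mul, ENNReal.div_mul_cancel (hpos x) (hfin x)]
  · rw [ENNReal.div_le_iff (hpos x) (hfin x), add_mul]
    exact hxU

/-- Positive shifts suffice: a negative one gives the reciprocal ratio at a translated point. -/
lemma classL_of_tendsto {H : AddSubgroup ℝ} (hH : argSet γ μ ⊆ H) (hpos : ∀ x, tail μ x ≠ 0)
    (hfin : ∀ x, tail μ x ≠ ∞)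
    (h : ∀ t ∈ H, 0 < t →
      Tendsto (fun x => tail μ (x - t) / tail μ x) atTop (𝓝 (expFactor γ t))) :
    ClassL γ μ := by
  intro t ht
  refine Tendsto.mono_left ?_ inf_le_left
  rcases lt_trichotomy t 0 with ht0 | rfl | ht0
  · have h1 := h (-t) (H.neg_mem (hH ht)) (by linarith)
    have h2 := h1.comp (tendsto_atTop_add_const_right atTop (-t) tendsto_id)
    have h3 := tendsto_inv_iff.2 h2
    have hE : (expFactor γ (-t))⁻¹ = ENNReal.ofReal (Real.exp (γ * t)) := by
      rw [expFactor, ← ENNReal.ofReal_inv_of_pos (Real.exp_pos _), ← Real.exp_neg]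
      congr 2; ring
    rw [hE] at h3
    refine h3.congr fun x => ?_
    simp only [Function.comp_apply, id, add_sub_cancel_right]
    rw [ENNReal.inv_div (Or.inl (hfin _)) (Or.inl (hpos _)), sub_eq_add_neg]
  · simp only [sub_zero, mul_zero, Real.exp_zero, ENNReal.ofReal_one]
    refine tendsto_const_nhds.congr fun x => ?_
    rw [ENNReal.div_self (hpos x) (hfin x)]
  · exact h t (hH ht) ht0

end ArgSet

/-! ### Lattices, cosets and spans. -/

section Lattice

variable {F : Measure ℝ} [IsProbabilityMeasure F] {γ d : ℝ} {n : ℕ}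

/-- If a convolution power of `F` is concentrated on a lattice, then all convolution powers of `F`
are concentrated on cosets of that lattice. -/
lemma exists_coset_of_convPow {i : ℕ} (hi : 1 ≤ i)
    (h : convPow F i ((AddSubgroup.zmultiples d : Set ℝ)ᶜ) = 0) (n : ℕ) :
    ∃ c : ℝ, ∀ᵐ y ∂(convPow F n), y - c ∈ AddSubgroup.zmultiples d := by
  have hmeas (c : ℝ) : MeasurableSet {y : ℝ | y - c ∈ AddSubgroup.zmultiples d} :=
    (measurableSet_zmultiples d).preimage (measurable_id.sub_const c)
  obtain ⟨a, ha⟩ : ∃ a : ℝ, ∀ᵐ y ∂F, y - a ∈ AddSubgroup.zmultiples d := by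
    obtain ⟨j, rfl⟩ := Nat.exists_eq_add_of_le' hi
    have h' : ∀ᵐ z ∂(convPow F (j + 1)), z ∈ AddSubgroup.zmultiples d := by rwa [ae_iff]
    rw [convPow_succ, Measure.conv, ae_map_iff (p := fun z => z ∈ AddSubgroup.zmultiples d) (by fun_prop)
      (measurableSet_zmultiples d)] at h'
    -- By Fubini the first `j` summands can be frozen at a value `u`, which puts `F` on the coset of
    -- `-u`.
    obtain ⟨u, hu⟩ := (Measure.ae_ae_of_ae_prod h').exists
    exact ⟨-u, hu.mono fun y hy => by rwa [sub_neg_eq_add, add_comm]⟩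
  induction n with
  | zero => exact ⟨0, ae_dirac_zero (by simp)⟩
  | succ n ih =>
    obtain ⟨c, hc⟩ := ih
    refine ⟨c + a, ae_conv hc ha (fun x y hx hy => ?_) (hmeas _)⟩
    rw [add_sub_add_comm]
    exact add_mem hx hy

lemma ClassL.tail_lt {μ : Measure ℝ} [IsProbabilityMeasure μ] (h : ClassL γ μ) (hγ : 0 < γ)
    {t : ℝ} (ht : t ∈ argSet γ μ) (ht0 : 0 < t) :
    ∀ᶠ x in atTop, tail μ x < tail μ (x - t) := by
  have h1 : 1 < expFactor γ t := by
    rw [expFactor, ENNReal.one_lt_ofReal]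
    exact Real.one_lt_exp_iff.2 (by positivity)
  refine ((h.tendsto ht).eventually_const_lt h1).mono fun x hx => ?_
  rwa [ENNReal.lt_div_iff_mul_lt (Or.inl (h.tail_ne_zero x)) (Or.inl (tail_ne_top x)),
    one_mul] at hx

lemma exists_mem_Ioc_of_tail_lt {μ : Measure ℝ} {x t : ℝ} (h : tail μ x < tail μ (x - t))
    {p : ℝ → Prop} (hp : ∀ᵐ y ∂μ, p y) : ∃ y, p y ∧ x - t < y ∧ y ≤ x := by
  by_contra! hc
  refine h.not_ge (measure_mono_ae ?_)
  filter_upwards [hp] with y hy hxy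
  exact hc y hy hxy

/-- A distribution in `L(γ)`, `γ > 0`, that lives on a coset of the lattice generated by `d'` is
a lattice distribution whose span is a multiple of `d'`. -/
lemma ClassL.argSet_subset_zmultiples {μ : Measure ℝ} [IsProbabilityMeasure μ]
    (h : ClassL γ μ) (hγ : 0 < γ) {d' c : ℝ} (hd' : 0 < d')
    (hc : ∀ᵐ y ∂μ, y - c ∈ AddSubgroup.zmultiples d') :
    argSet γ μ ⊆ AddSubgroup.zmultiples d' := by
  rcases argSet_cases γ μ with hu | ⟨-, d, ⟨hd, hμ, -⟩, hS⟩
  · exfalso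
    have ht : d' / 2 ∈ argSet γ μ := hu ▸ mem_univ _
    obtain ⟨X, hX⟩ := eventually_atTop.1 (h.tail_lt hγ ht (by positivity))
    obtain ⟨m, hm⟩ := exists_int_gt ((X - c) / d')
    rw [div_lt_iff₀ hd'] at hm
    -- The interval between `c + (m + 1/4) d'` and `c + (m + 3/4) d'` would carry mass but misses
    -- the coset.
    obtain ⟨y, hy, hy1, hy2⟩ := exists_mem_Ioc_of_tail_lt
      (hX (c + m * d' + 3 / 4 * d') (by linarith)) hc
    obtain ⟨k, hk⟩ := AddSubgroup.mem_zmultiples_iff.1 hy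
    rw [zsmul_eq_mul] at hk
    have h1 : (m : ℝ) < k := by
      rw [← mul_lt_mul_iff_left₀ hd']; linarith
    have h2 : (k : ℝ) < m + 1 := by
      rw [← mul_lt_mul_iff_left₀ hd']; linarith
    norm_cast at h1 h2
    omega
  · have hae : ∀ᵐ y ∂μ, y ∈ AddSubgroup.zmultiples d := by rwa [ae_iff]
    have hdS : d ∈ argSet γ μ := by rw [hS]; exact AddSubgroup.mem_zmultiples d
    obtain ⟨X, hX⟩ := eventually_atTop.1 (h.tail_lt hγ hdS hd)
    -- Every far multiple of `d` is an atom, hence lies in the coset; the difference of two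
    -- neighbours is `d`.
    have key (m : ℤ) (hm : X ≤ m * d) : m * d - c ∈ AddSubgroup.zmultiples d' := by
      obtain ⟨y, ⟨hy, hy'⟩, hy1, hy2⟩ := exists_mem_Ioc_of_tail_lt (hX _ hm) (hc.and hae)
      obtain ⟨k, rfl⟩ := AddSubgroup.mem_zmultiples_iff.1 hy'
      rw [zsmul_eq_mul] at hy hy1 hy2
      have h1 : (m : ℝ) - 1 < k := by
        rw [← mul_lt_mul_iff_left₀ hd]; linarith
      have h2 : (k : ℝ) ≤ m := by
        rwa [mul_le_mul_iff_left₀ hd] at hy2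
      have : k = m := by
        norm_cast at h2
        have h1' : ((m - 1 : ℤ) : ℝ) < k := by push_cast; exact h1
        norm_cast at h1'
        omega
      rwa [this] at hy
    obtain ⟨m, hm⟩ := exists_int_gt (X / d)
    rw [div_lt_iff₀ hd] at hm
    have hdm : d ∈ AddSubgroup.zmultiples d' := by
      have := sub_mem (key (m + 1) (by push_cast; linarith)) (key m hm.le)
      convert this using 1
      push_cast; ring
    rw [hS]
    exact AddSubgroup.zmultiples_le_of_mem hdm

lemma argSet_convPow_subset (hL : ClassL γ (convPow F n)) {i : ℕ} (hi : 1 ≤ i) :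
    argSet γ (convPow F n) ⊆ argSet γ (convPow F i) := by
  intro t ht hγ d' hd'
  obtain ⟨c, hc⟩ := exists_coset_of_convPow hi hd'.2.1 n
  exact hL.argSet_subset_zmultiples hγ hd'.1 hc ht

/-- A larger span `d'` of the mixture would put `F^{*k}` on its lattice and `F^{*n}` on a coset of
it, making `d < d'` a multiple of `d'`. -/
lemma argSet_mixture_subset {p : ℕ → ℝ≥0∞} (hL : ClassL γ (convPow F n))
    (hspan : 0 < γ → ∀ d, IsLatticeWithSpan (convPow F n) d → IsLatticeWithSpan F d)
    {k : ℕ} (hk : 1 ≤ k) (hpk : p k ≠ 0) :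
    argSet γ (mixture p F) ⊆ argSet γ (convPow F n) := by
  intro t ht hγ d hd
  refine ht hγ d ⟨hd.1, ?_, fun d' hdd' h0 => ?_⟩
  · rw [mixture, Measure.sum_apply _ (measurableSet_zmultiples d).compl,
      ENNReal.tsum_eq_zero]
    intro j
    have hFd : ∀ᵐ y ∂F, y ∈ AddSubgroup.zmultiples d := by
      rw [ae_iff]; exact (hspan hγ d hd).2.1
    have := convPow_mem _ (measurableSet_zmultiples d) hFd j
    rw [ae_iff] at this
    rw [Measure.smul_apply, smul_eq_mul]
    exact mul_eq_zero_of_right _ this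
  · rw [mixture, Measure.sum_apply _ (measurableSet_zmultiples d').compl,
      ENNReal.tsum_eq_zero] at h0
    have h1 := h0 k
    rw [Measure.smul_apply, smul_eq_mul, mul_eq_zero, or_iff_right hpk] at h1
    obtain ⟨c, hc⟩ := exists_coset_of_convPow hk h1 n
    have hsub := hL.argSet_subset_zmultiples hγ (hd.1.trans hdd') hc
    rw [argSet_eq_zmultiples hγ hd] at hsub
    obtain ⟨m, hm⟩ := AddSubgroup.mem_zmultiples_iff.1 (hsub (AddSubgroup.mem_zmultiples d))
    rw [zsmul_eq_mul] at hm
    have hd0 := hd.1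
    have h2 : (0 : ℝ) < m := by
      by_contra! hm0
      nlinarith
    have h3 : (1 : ℝ) ≤ m := by exact_mod_cast h2
    nlinarith

/-- Countably many short intervals cover the line; on a lattice, single points do and `δ = 0` is
allowed. -/
lemma exists_Icc_ne_zero {ν : Measure ℝ} [IsProbabilityMeasure ν] {H : Set ℝ}
    (hH : H = univ ∨ ∃ d : ℝ, 0 < d ∧ ν ((AddSubgroup.zmultiples d : Set ℝ)ᶜ) = 0 ∧
      H = AddSubgroup.zmultiples d) {η : ℝ} (hη : 0 < η) :
    ∃ δ ∈ H, 0 ≤ δ ∧ δ < η ∧ ∃ a, ν (Icc a (a + δ)) ≠ 0 := by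
  rcases hH with rfl | ⟨d, hd, hν, rfl⟩
  · refine ⟨η / 2, mem_univ _, by positivity, by linarith, ?_⟩
    by_contra! h
    refine one_ne_zero (α := ℝ≥0∞) ?_
    rw [← measure_univ (μ := ν)]
    refine measure_mono_null (t := ⋃ m : ℤ, Icc (m * (η / 2)) (m * (η / 2) + η / 2)) ?_
      (measure_iUnion_null fun m => h _)
    intro y _
    have hη2 : 0 < η / 2 := by positivity
    have h1 := Int.floor_le (y / (η / 2))
    have h2 := Int.lt_floor_add_one (y / (η / 2))
    rw [le_div_iff₀ hη2] at h1
    rw [div_lt_iff₀ hη2] at h2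
    exact mem_iUnion.2 ⟨⌊y / (η / 2)⌋, h1, by linarith⟩
  · refine ⟨0, zero_mem _, le_rfl, hη, ?_⟩
    by_contra! h
    refine one_ne_zero (α := ℝ≥0∞) ?_
    rw [← measure_univ (μ := ν)]
    refine measure_mono_null (t := (AddSubgroup.zmultiples d : Set ℝ)ᶜ ∪
      ⋃ m : ℤ, Icc (m • d) (m • d + 0)) ?_ (measure_union_null hν (measure_iUnion_null fun m => h _))
    intro y _
    by_cases hy : y ∈ AddSubgroup.zmultiples d
    · obtain ⟨m, rfl⟩ := AddSubgroup.mem_zmultiples_iff.1 hy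
      exact Or.inr (mem_iUnion.2 ⟨m, by simp⟩)
    · exact Or.inl hy

end Lattice

/-! ### Condition (b): lower powers are negligible. -/

section SmallO

variable {μ ν : Measure ℝ} {F : Measure ℝ} [IsProbabilityMeasure F] {n : ℕ}

lemma mul_tail_le_tail_conv [SFinite μ] [SFinite ν] (B x : ℝ) :
    tail μ (x - B) * tail ν B ≤ tail (μ.conv ν) x := by
  calc tail μ (x - B) * tail ν B = ∫⁻ _ in Ioi B, tail μ (x - B) ∂ν := by simp [tail]
    _ ≤ tailOn μ ν (Ioi B) x := setLIntegral_mono' measurableSet_Ioi fun y hy =>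
        tail_antitone μ (by have : B < y := hy; linarith)
    _ ≤ _ := tailOn_le _ _

lemma tail_ne_zero_of_convPow (h : ∀ x, tail (convPow F n) x ≠ 0) (x : ℝ) : tail F x ≠ 0 := by
  intro hx
  have hF : ∀ᵐ y ∂F, y ≤ x := by
    rw [ae_iff]; simpa [tail, Ioi] using hx
  have key (k : ℕ) : ∀ᵐ y ∂(convPow F k), y ≤ k * x := by
    induction k with
    | zero => exact ae_dirac_zero (by simp)
    | succ k ih =>
      exact ae_conv ih hF (fun a b ha hb => by push_cast; linarith) measurableSet_Iic
  have := key n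
  rw [ae_iff] at this
  refine h (n * x) ?_
  simpa [tail, Ioi] using this

lemma tail_convPow_ne_zero (hF : F (Iio 0) = 0) (h : ∀ x, tail F x ≠ 0) {k : ℕ} (hk : 1 ≤ k)
    (x : ℝ) : tail (convPow F k) x ≠ 0 := by
  have h1 := tail_convPow_mono hF x hk
  simp only [convPow_one] at h1
  exact fun h0 => h x (le_antisymm (h1.trans h0.le) zero_le)

/-- Induction on `k`, conditioning on the summand `Y ~ F^{*k}`: for `Y ≤ x - B` the hypothesis on
`F` applies at `x - Y ≥ B`. -/
lemma tail_convPow_le_succ (hF : F (Iio 0) = 0) (hpos : ∀ x, tail F x ≠ 0)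
    (h : TailLittleO F (convPow F 2)) (k : ℕ) :
    ∀ ε : ℝ≥0∞, ε ≠ 0 →
      ∀ᶠ x in atTop, tail (convPow F k) x ≤ ε * tail (convPow F (k + 1)) x := by
  induction k with
  | zero =>
    intro ε _
    filter_upwards [eventually_ge_atTop 0] with x hx
    rw [tail_convPow_zero hx]
    exact zero_le
  | succ k ih =>
    intro ε hε
    have hε2 : 0 < ε / 2 := ENNReal.half_pos hε
    obtain ⟨B, hB⟩ := eventually_atTop.1 (ENNReal.tendsto_nhds_zero.1 h (ε / 2) hε2)
    obtain ⟨δ, hδ, -, hδB⟩ := exists_ne_zero_mul_le (C := (tail F B)⁻¹)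
      (by simpa using hpos B) hε2.ne'
    have hδB' : δ ≤ ε / 2 * tail F B := by
      calc δ = δ * (tail F B)⁻¹ * tail F B := by
            rw [mul_assoc, ENNReal.inv_mul_cancel (hpos B) (tail_ne_top B), mul_one]
        _ ≤ _ := by gcongr
    have hih := (tendsto_atTop_add_const_right atTop (-B) tendsto_id).eventually (ih δ hδ)
    refine hih.mono fun x hx => ?_
    simp only [id, ← sub_eq_add_neg] at hx
    set T := tail (convPow F (k + 1 + 1)) x with hT
    have h1 : tailOn F (convPow F k) (Iic (x - B)) x ≤ ε / 2 * T := by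
      calc tailOn F (convPow F k) (Iic (x - B)) x
          ≤ ∫⁻ y in Iic (x - B), ε / 2 * tail (convPow F 2) (x - y) ∂(convPow F k) := by
            refine setLIntegral_mono' measurableSet_Iic fun y hy => ?_
            rw [mem_Iic] at hy
            have hpos2 := tail_convPow_ne_zero hF hpos one_le_two (x - y)
            exact (ENNReal.div_le_iff hpos2 (tail_ne_top _)).1 (hB (x - y) (by linarith))
        _ = ε / 2 * tailOn (convPow F 2) (convPow F k) (Iic (x - B)) x :=
            lintegral_const_mul _ (measurable_tail_sub _ _)
        _ ≤ ε / 2 * T := by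
            gcongr
            refine (tailOn_le _ _).trans (le_of_eq ?_)
            rw [← convPow_add, hT]
            congr 2
            ring
    -- For `Y > x - B` the induction hypothesis provides a sum of `k + 1` terms above `x - B`; one
    -- further term above `B`, of fixed probability, brings it above `x`.
    have h2 : tailOn F (convPow F k) (Ioi (x - B)) x ≤ ε / 2 * T := by
      calc tailOn F (convPow F k) (Ioi (x - B)) x
          ≤ ∫⁻ _ in Ioi (x - B), 1 ∂(convPow F k) :=
            setLIntegral_mono' measurableSet_Ioi fun _ _ => tail_le_one _
        _ = tail (convPow F k) (x - B) := by simp [tail]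
        _ ≤ (ε / 2 * tail F B) * tail (convPow F (k + 1)) (x - B) := hx.trans (by gcongr)
        _ = ε / 2 * (tail (convPow F (k + 1)) (x - B) * tail F B) := by ring
        _ ≤ ε / 2 * T := by
            gcongr
            exact mul_tail_le_tail_conv B x
    have h3 : tail (convPow F (k + 1)) x =
        tailOn F (convPow F k) (Iic (x - B)) x + tailOn F (convPow F k) (Ioi (x - B)) x := by
      rw [tailOn_Iic_add_Ioi]
      nth_rewrite 2 [← convPow_one (F := F)]
      rw [← convPow_add, add_comm]
    rw [h3, ← ENNReal.add_halves ε, add_mul]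
    exact add_le_add h1 h2

lemma tail_convPow_le_of_littleO (hF : F (Iio 0) = 0) (hpos : ∀ x, tail F x ≠ 0)
    (h : TailLittleO F (convPow F 2)) {i : ℕ} (hi : i < n) {ε : ℝ≥0∞} (hε : ε ≠ 0) :
    ∀ᶠ x in atTop, tail (convPow F i) x ≤ ε * tail (convPow F n) x :=
  (tail_convPow_le_succ hF hpos h i ε hε).mono fun x hx =>
    hx.trans (by gcongr; exact tail_convPow_mono hF x hi)

variable {κ : Measure ℝ} {E : ℝ≥0∞} {t : ℝ}

lemma shiftUpper_of_littleO (hκ : ShiftBounded κ)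
    (h : ∀ ε : ℝ≥0∞, ε ≠ 0 → ∀ᶠ x in atTop, tail μ x ≤ ε * tail κ x) : ShiftUpper E t μ κ := by
  intro ε hε
  obtain ⟨C, hC, hCb⟩ := hκ t
  obtain ⟨δ, hδ, -, hδC⟩ := exists_ne_zero_mul_le hC hε
  refine ((tendsto_atTop_add_const_right atTop (-t) tendsto_id).eventually (h δ hδ)).mono
    fun x hx => ?_
  simp only [id, ← sub_eq_add_neg] at hx
  refine le_trans ?_ le_add_self
  calc tail μ (x - t) ≤ δ * (C * tail κ x) := hx.trans (by gcongr; exact hCb x)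
    _ = δ * C * tail κ x := by ring
    _ ≤ _ := by gcongr

lemma shiftLower_of_littleO (hE : E ≠ ∞)
    (h : ∀ ε : ℝ≥0∞, ε ≠ 0 → ∀ᶠ x in atTop, tail μ x ≤ ε * tail κ x) : ShiftLower E t μ κ := by
  intro ε hε
  obtain ⟨δ, hδ, -, hδE⟩ := exists_ne_zero_mul_le hE hε
  refine (h δ hδ).mono fun x hx => le_trans ?_ le_add_self
  calc E * tail μ x ≤ E * (δ * tail κ x) := by gcongr
    _ = δ * E * tail κ x := by ring
    _ ≤ _ := by gcongr

end SmallO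

/-! ### Lower bounds by Fatou's lemma. -/

section Liminf

variable {G μ ν : Measure ℝ} {γ : ℝ}

/-- For fixed `y`, factor `tail μ (x - y) / tail G x` through `tail G (x - y)`, then integrate by
Fatou. The cut at `x / 2` disappears in the limit and keeps the two cases of a large summand
disjoint. -/
lemma lintegral_expFactor_mul_le_liminf [IsProbabilityMeasure G] (hG : ClassL γ G)
    (hν : ∀ᵐ y ∂ν, y ∈ argSet γ G) :
    (∫⁻ y, expFactor γ y ∂ν) * liminf (fun x => tail μ x / tail G x) atTop ≤
      liminf (fun x => tailOn μ ν (Iic (x / 2)) x / tail G x) atTop := by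
  set r := liminf (fun x => tail μ x / tail G x) atTop with hr
  set f : ℝ → ℝ → ℝ≥0∞ := fun x y => (Iic (x / 2)).indicator (fun y => tail μ (x - y)) y / tail G x
  have hf (x : ℝ) : Measurable (f x) :=
    ((measurable_tail_sub μ x).indicator measurableSet_Iic).div_const _
  calc (∫⁻ y, expFactor γ y ∂ν) * r = ∫⁻ y, expFactor γ y * r ∂ν :=
        (lintegral_mul_const _ (continuous_expFactor γ).measurable).symm
    _ ≤ ∫⁻ y, liminf (fun x => f x y) atTop ∂ν := by
        refine lintegral_mono_ae ?_
        filter_upwards [hν] with y hy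
        have h1 : r ≤ liminf (fun x => tail μ (x - y) / tail G (x - y)) atTop :=
          (tendsto_atTop_add_const_right atTop (-y) tendsto_id).liminf_le_liminf_comp
            (u := fun x => tail μ x / tail G x)
        have h2 := (hG.tendsto hy).liminf_eq
        calc expFactor γ y * r ≤ liminf (fun x => tail G (x - y) / tail G x) atTop *
              liminf (fun x => tail μ (x - y) / tail G (x - y)) atTop := by
              rw [h2]; gcongr
          _ ≤ _ := ENNReal.le_liminf_mul
          _ = _ := by
              refine liminf_congr ?_
              filter_upwards [eventually_ge_atTop (2 * y)] with x hx
              simp only [f, Pi.mul_apply]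
              rw [indicator_of_mem (mem_Iic.2 (by linarith)), mul_comm, div_eq_mul_inv,
                div_eq_mul_inv, div_eq_mul_inv, mul_assoc, ← mul_assoc _ (tail G (x - y)),
                ENNReal.inv_mul_cancel (hG.tail_ne_zero _) (tail_ne_top _), one_mul]
    _ ≤ liminf (fun x => ∫⁻ y, f x y ∂ν) atTop := lintegral_liminf_le hf
    _ = _ := by
        congr 1
        ext x
        simp only [f, div_eq_mul_inv]
        rw [lintegral_mul_const _ ((measurable_tail_sub μ x).indicator measurableSet_Iic),
          lintegral_indicator measurableSet_Iic, tailOn]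

lemma lintegral_expFactor_conv [SFinite μ] [SFinite ν] :
    ∫⁻ y, expFactor γ y ∂(μ.conv ν) = (∫⁻ y, expFactor γ y ∂μ) * ∫⁻ y, expFactor γ y ∂ν := by
  have hm := (continuous_expFactor γ).measurable
  rw [Measure.lintegral_conv hm]
  simp_rw [expFactor_add, lintegral_const_mul _ hm]
  rw [lintegral_mul_const _ hm]

lemma lintegral_expFactor_convPow [IsProbabilityMeasure G] (k : ℕ) :
    ∫⁻ y, expFactor γ y ∂(convPow G k) = (∫⁻ y, expFactor γ y ∂G) ^ k := by
  induction k with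
  | zero =>
    rw [convPow_zero, lintegral_dirac]
    simp [expFactor]
  | succ k ih => rw [convPow_succ, lintegral_expFactor_conv, ih, pow_succ]

lemma expMoment_eq (hμ : μ (Iio 0) = 0) : expMoment γ μ = ∫⁻ y, expFactor γ y ∂μ := by
  rw [expMoment, Measure.restrict_eq_self_of_ae_mem]
  · rfl
  · exact ae_nonneg_iff.2 hμ

/-- Two summands that are both at most `x / 2` cannot add up to more than `x`. -/
lemma tailOn_add_tailOn_le [SFinite μ] [SFinite ν] (x : ℝ) :
    tailOn μ ν (Iic (x / 2)) x + tailOn ν μ (Iic (x / 2)) x ≤ tail (μ.conv ν) x := by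
  rw [← tailOn_Iic_add_Ioi (x / 2) x, tailOn_Ioi (x / 2) x]
  gcongr
  refine le_trans ?_ (setLIntegral_le_lintegral (Iic (x / 2)) _)
  refine setLIntegral_mono' measurableSet_Iic fun u hu => ?_
  rw [mem_Iic] at hu
  rw [max_eq_left (by linarith)]

lemma liminf_tail_div_self [IsProbabilityMeasure G] (hG : ClassL γ G) :
    liminf (fun x => tail G x / tail G x) atTop = 1 := by
  simp_rw [ENNReal.div_self (hG.tail_ne_zero _) (tail_ne_top _)]
  exact liminf_const _

lemma liminf_add_liminf_le (u v : ℝ → ℝ≥0∞) :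
    liminf u atTop + liminf v atTop ≤ liminf (fun x => u x + v x) atTop := by
  have h := lintegral_liminf_le (μ := Measure.count) (u := atTop)
    (f := fun (x : ℝ) (b : Bool) => cond b (u x) (v x)) fun _ => Measurable.of_discrete
  simpa [lintegral_count, tsum_fintype] using h

/-- Lower bound on the tail of convolution powers of a distribution in `L(γ)`. -/
lemma le_liminf_tail_convPow [IsProbabilityMeasure G] (hG : ClassL γ G)
    (hmem : ∀ k, ∀ᵐ y ∂(convPow G k), y ∈ argSet γ G) (m : ℕ) :
    ((m + 1 : ℕ) : ℝ≥0∞) * (∫⁻ y, expFactor γ y ∂G) ^ m ≤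
      liminf (fun x => tail (convPow G (m + 1)) x / tail G x) atTop := by
  induction m with
  | zero => rw [convPow_one, liminf_tail_div_self hG]; simp
  | succ m ih =>
    set M := ∫⁻ y, expFactor γ y ∂G with hM
    have hG1 := hmem 1
    rw [convPow_one] at hG1
    have h1 := lintegral_expFactor_mul_le_liminf (μ := convPow G (m + 1)) hG hG1
    have h2 := lintegral_expFactor_mul_le_liminf (μ := G) hG (hmem (m + 1))
    rw [liminf_tail_div_self hG, mul_one, lintegral_expFactor_convPow] at h2
    calc ((m + 1 + 1 : ℕ) : ℝ≥0∞) * M ^ (m + 1)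
        = M * (((m + 1 : ℕ) : ℝ≥0∞) * M ^ m) + M ^ (m + 1) := by push_cast; ring
      _ ≤ liminf (fun x => tailOn (convPow G (m + 1)) G (Iic (x / 2)) x / tail G x) atTop +
            liminf (fun x => tailOn G (convPow G (m + 1)) (Iic (x / 2)) x / tail G x) atTop :=
          add_le_add ((mul_le_mul' le_rfl ih).trans h1) h2
      _ ≤ liminf (fun x => tailOn (convPow G (m + 1)) G (Iic (x / 2)) x / tail G x +
            tailOn G (convPow G (m + 1)) (Iic (x / 2)) x / tail G x) atTop :=
          liminf_add_liminf_le _ _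
      _ ≤ _ := by
        refine liminf_le_liminf (Eventually.of_forall fun x => ?_)
        rw [← ENNReal.add_div, convPow_succ (m + 1)]
        gcongr
        exact tailOn_add_tailOn_le x

lemma lintegral_expFactor_le_liminf_conv [IsProbabilityMeasure G] [SFinite ν] (hG : ClassL γ G)
    (hν : ∀ᵐ y ∂ν, y ∈ argSet γ G) :
    ∫⁻ y, expFactor γ y ∂ν ≤ liminf (fun x => tail (G.conv ν) x / tail G x) atTop := by
  have h := lintegral_expFactor_mul_le_liminf (μ := G) hG hν
  rw [liminf_tail_div_self hG, mul_one] at h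
  refine h.trans (liminf_le_liminf (Eventually.of_forall fun x => ?_))
  gcongr
  exact tailOn_le _ _

lemma tsum_sum_Icc_le {n : ℕ} (hn : 1 ≤ n) (g : ℕ → ℝ≥0∞) :
    ∑' m : ℕ, ∑ k ∈ Finset.Icc (n * (m + 1)) (n * (m + 2) - 1), g k ≤ ∑' k, g k := by
  calc ∑' m : ℕ, ∑ k ∈ Finset.Icc (n * (m + 1)) (n * (m + 2) - 1), g k
      -- Each `k` is assigned to one block, `k / n - 1`; the truncated value for `k < n` only
      -- enlarges the sum.
      ≤ ∑' m : ℕ, ∑' k, if m = k / n - 1 then g k else 0 := by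
        refine ENNReal.tsum_le_tsum fun m => ?_
        refine le_trans (Finset.sum_le_sum fun k hk => ?_) (ENNReal.sum_le_tsum _)
        rw [Finset.mem_Icc] at hk
        have hpos : 0 < n * (m + 2) := by positivity
        have hlt : k < n * (m + 2) := by omega
        have h1 : k / n = m + 1 := Nat.div_eq_of_lt_le (by rw [mul_comm]; exact hk.1)
          (by rwa [mul_comm])
        rw [if_pos (by omega)]
    _ = ∑' k, ∑' m : ℕ, if m = k / n - 1 then g k else 0 := ENNReal.tsum_comm
    _ = _ := by simp_rw [tsum_ite_eq]

variable {F : Measure ℝ} [IsProbabilityMeasure F] {n : ℕ} {p : ℕ → ℝ≥0∞}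

/-- Within a block each power dominates the first one, which is a power of `F^{*n}`; Fatou for
counting measure handles the sum over blocks. -/
lemma tsum_le_liminf_tail_mixture (hF : F (Iio 0) = 0) (hn : 1 ≤ n)
    (hG : ClassL γ (convPow F n)) (hmem : ∀ k, ∀ᵐ y ∂(convPow F k), y ∈ argSet γ (convPow F n)) :
    ∑' m : ℕ, ((m + 1 : ℕ) : ℝ≥0∞) *
        (∑ k ∈ Finset.Icc (n * (m + 1)) (n * (m + 2) - 1), p k) *
        expMoment γ (convPow F n) ^ m ≤
      liminf (fun x => tail (mixture p F) x / tail (convPow F n) x) atTop := by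
  rw [expMoment_eq (convPow_Iio hF n)]
  set M := ∫⁻ y, expFactor γ y ∂(convPow F n) with hM
  set q : ℕ → ℝ≥0∞ := fun m => ∑ k ∈ Finset.Icc (n * (m + 1)) (n * (m + 2) - 1), p k
  set f : ℝ → ℕ → ℝ≥0∞ := fun x m =>
    q m * (tail (convPow F (n * (m + 1))) x / tail (convPow F n) x)
  calc ∑' m : ℕ, ((m + 1 : ℕ) : ℝ≥0∞) * q m * M ^ m
      ≤ ∑' m : ℕ, liminf (fun x => f x m) atTop := by
        refine ENNReal.tsum_le_tsum fun m => ?_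
        have h := le_liminf_tail_convPow hG (fun k => by rw [← convPow_mul]; exact hmem _) m
        rw [← convPow_mul] at h
        calc ((m + 1 : ℕ) : ℝ≥0∞) * q m * M ^ m
            = q m * (((m + 1 : ℕ) : ℝ≥0∞) * M ^ m) := by ring
          _ ≤ liminf (fun _ : ℝ => q m) atTop * liminf (fun x =>
                tail (convPow F (n * (m + 1))) x / tail (convPow F n) x) atTop := by
              rw [liminf_const]; gcongr
          _ ≤ _ := ENNReal.le_liminf_mul
    _ = ∫⁻ m, liminf (fun x => f x m) atTop ∂Measure.count := (lintegral_count _).symm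
    _ ≤ liminf (fun x => ∫⁻ m, f x m ∂Measure.count) atTop :=
        lintegral_liminf_le fun _ => measurable_from_nat
    _ ≤ _ := by
        refine liminf_le_liminf (Eventually.of_forall fun x => ?_)
        rw [lintegral_count]
        simp only [f, div_eq_mul_inv, ← mul_assoc]
        rw [ENNReal.tsum_mul_right]
        gcongr
        rw [tail_mixture]
        refine le_trans (ENNReal.tsum_le_tsum fun m => ?_) (tsum_sum_Icc_le hn _)
        rw [Finset.sum_mul]
        refine Finset.sum_le_sum fun k hk => ?_
        gcongr
        exact tail_convPow_mono hF x (Finset.mem_Icc.1 hk).1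

lemma tailLittleO_mixture (hF : F (Iio 0) = 0)
    (hG : ClassL γ (convPow F n)) (hmem : ∀ᵐ y ∂F, y ∈ argSet γ (convPow F n))
    (hM : expMoment γ (convPow F n) = ∞) {k : ℕ} (hk : n + 1 ≤ k) (hpk : p k ≠ 0) :
    TailLittleO (convPow F n) (mixture p F) := by
  rw [expMoment_eq (convPow_Iio hF n), lintegral_expFactor_convPow] at hM
  have hMF : ∫⁻ y, expFactor γ y ∂F = ∞ := by
    by_contra h
    exact ENNReal.pow_ne_top h hM
  have hlim := lintegral_expFactor_le_liminf_conv hG hmem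
  rw [hMF, ← convPow_succ] at hlim
  refine ENNReal.tendsto_nhds_zero.2 fun ε hε => ?_
  obtain ⟨δ, hδ, hδt, hδε⟩ := exists_ne_zero_mul_le (C := 1) (by simp)
    (mul_ne_zero hpk hε.ne')
  rw [mul_one] at hδε
  have hev := eventually_lt_of_lt_liminf
    (lt_of_lt_of_le (ENNReal.inv_lt_top.2 hδ.bot_lt) hlim)
  refine hev.mono fun x hx => ?_
  have h1 : δ⁻¹ * tail (convPow F n) x ≤ tail (convPow F (n + 1)) x := by
    rw [ENNReal.lt_div_iff_mul_lt (Or.inl (hG.tail_ne_zero x)) (Or.inl (tail_ne_top x))] at hx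
    exact hx.le
  refine ENNReal.div_le_of_le_mul ?_
  calc tail (convPow F n) x = δ * (δ⁻¹ * tail (convPow F n) x) := by
        rw [← mul_assoc, ENNReal.mul_inv_cancel hδ hδt, one_mul]
    _ ≤ (p k * ε) * tail (convPow F k) x :=
        mul_le_mul' hδε (h1.trans (tail_convPow_mono hF x hk))
    _ = ε * (p k * tail (convPow F k) x) := by ring
    _ ≤ _ := by gcongr; exact mul_tail_le_tail_mixture k x

end Liminf

/-! ### The powers below `n`, and the theorem. -/

section Main

lemma exists_addSubgroup_eq_argSet (γ : ℝ) (μ : Measure ℝ) :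
    ∃ H : AddSubgroup ℝ, (H : Set ℝ) = argSet γ μ ∧ MeasurableSet (H : Set ℝ) := by
  rcases argSet_cases γ μ with hu | ⟨-, d, -, hS⟩
  · exact ⟨⊤, by simp [hu], MeasurableSet.univ⟩
  · exact ⟨AddSubgroup.zmultiples d, hS.symm, measurableSet_zmultiples d⟩

lemma ae_mem_argSet {F : Measure ℝ} {n : ℕ} {γ : ℝ}
    (hspan : 0 < γ → ∀ d, IsLatticeWithSpan (convPow F n) d → IsLatticeWithSpan F d) :
    ∀ᵐ y ∂F, y ∈ argSet γ (convPow F n) := by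
  rcases argSet_cases γ (convPow F n) with hu | ⟨hγ, d, hd, hS⟩
  · simp [hu]
  · rw [hS, ae_iff]
    exact (hspan hγ d hd).2.1

variable {F : Measure ℝ} [IsProbabilityMeasure F] {n : ℕ} {γ : ℝ}

/-- The tails of the lower convolution powers satisfy the defining relation of `L(γ)` up to
`o(tail F^{*n})`. -/
lemma shift_convPow_of_lt (hF : F (Iio 0) = 0) (hL : ClassL γ (convPow F n))
    (hspan : 0 < γ → ∀ d, IsLatticeWithSpan (convPow F n) d → IsLatticeWithSpan F d)
    (hcond : (∀ i : ℕ, 1 ≤ i → i ≤ n - 1 → LiminfCond γ (convPow F i)) ∨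
      TailLittleO F (convPow F 2))
    {i : ℕ} (hi : i < n) {t : ℝ} (ht : t ∈ argSet γ (convPow F n)) (ht0 : 0 < t) :
    ShiftUpper (expFactor γ t) t (convPow F i) (convPow F n) ∧
      ShiftLower (expFactor γ t) t (convPow F i) (convPow F n) := by
  have hposF := tail_ne_zero_of_convPow hL.tail_ne_zero
  rcases Nat.eq_zero_or_pos i with rfl | hi0
  · exact ⟨shiftUpper_convPow_zero _ _ _, shiftLower_convPow_zero _ _ _⟩
  rcases hcond with ha | hb
  · obtain ⟨H, hH, hHm⟩ := exists_addSubgroup_eq_argSet γ (convPow F n)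
    have hmem (s : ℝ) : s ∈ H ↔ s ∈ argSet γ (convPow F n) := by rw [← hH]; rfl
    have hlow (j : ℕ) (hj : 1 ≤ j) (hjn : j ≤ n - 1) (s : ℝ) (hs : s ∈ H) (hs0 : 0 < s) :
        ShiftLower (expFactor γ s) s (convPow F j) (convPow F j) :=
      (ha j hj hjn).shiftLower (tail_convPow_ne_zero hF hposF hj)
        (argSet_convPow_subset hL hj ((hmem s).1 hs)) hs0
    obtain ⟨j, rfl⟩ := Nat.exists_eq_add_of_lt hi
    refine ⟨?_, (hlow i hi0 (by omega) t ((hmem t).2 ht) ht0).mono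
      fun x => tail_convPow_mono hF x hi.le⟩
    -- Both factors have order between `1` and `n - 1`, so (a) gives lower bounds for each and the
    -- deconvolution applies.
    have hn : convPow F (i + j + 1) = (convPow F i).conv (convPow F (j + 1)) := by
      rw [add_assoc, convPow_add]
    have hI (η : ℝ) (hη : 0 < η) :
        ∃ δ ∈ H, 0 ≤ δ ∧ δ < η ∧ ∃ a, convPow F (j + 1) (Icc a (a + δ)) ≠ 0 := by
      refine exists_Icc_ne_zero (H := H) ?_ hη
      rcases argSet_cases γ (convPow F (i + j + 1)) with hu | ⟨hγ, d, hd, hS⟩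
      · exact Or.inl (hH.trans hu)
      · refine Or.inr ⟨d, hd.1, ?_, hH.trans hS⟩
        have hFd : ∀ᵐ y ∂F, y ∈ AddSubgroup.zmultiples d := by
          rw [ae_iff]; exact (hspan hγ d hd).2.1
        have := convPow_mem _ (measurableSet_zmultiples d) hFd (j + 1)
        rwa [ae_iff] at this
    have hb := hL.shiftBounded
    have hU (s : ℝ) (hs : s ∈ H) := hL.shiftUpper ((hmem s).1 hs)
    rw [hn] at hb hU ⊢
    exact shiftUpper_of_shiftLower (convPow_Iio hF _) (hlow (j + 1) (by omega) (by omega))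
      (hlow i hi0 (by omega)) (fun s hs _ => hU s hs) hb hI ((hmem t).2 ht) ht0
  · have ho : ∀ ε : ℝ≥0∞, ε ≠ 0 →
        ∀ᶠ x in atTop, tail (convPow F i) x ≤ ε * tail (convPow F n) x :=
      fun ε hε => tail_convPow_le_of_littleO hF hposF hb hi hε
    exact ⟨shiftUpper_of_littleO hL.shiftBounded ho,
      shiftLower_of_littleO (expFactor_ne_top γ t) ho⟩

end Main

end RandomConv

open RandomConv in
theorem theorem2p3
    (F : Measure ℝ) [IsProbabilityMeasure F] (hF : F (Iio 0) = 0)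
    (n : ℕ) (hn : 1 ≤ n) (γ : ℝ) (hγ : 0 ≤ γ)
    {Ω : Type*} [MeasurableSpace Ω] (P : Measure Ω) [IsProbabilityMeasure P]
    (τ : Ω → ℕ) (hτ : Measurable τ)
    (hL : RandomConv.ClassL γ (RandomConv.convPow F n))
    -- only of interest for lattice distributions: `F` has the same span as its `n`-th convolution
    (hspan : 0 < γ → ∀ d : ℝ, RandomConv.IsLatticeWithSpan (RandomConv.convPow F n) d →
      RandomConv.IsLatticeWithSpan F d)
    (hpos : 0 < P {ω | n ≤ τ ω})
    (htail : RandomConv.TailSumCond P τ F)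
    (hcond : (∀ i : ℕ, 1 ≤ i → i ≤ n - 1 → RandomConv.LiminfCond γ (RandomConv.convPow F i)) ∨
      RandomConv.TailLittleO F (RandomConv.convPow F 2)) :
    RandomConv.ClassL γ (RandomConv.randomConv P τ F) ∧
    -- the sum over `m ≥ 1`, written with `m + 1` for `m`
    ∑' m : ℕ, ((m + 1 : ℕ) : ℝ≥0∞) *
          (∑ k ∈ Finset.Icc (n * (m + 1)) (n * (m + 2) - 1), RandomConv.prob P τ k) *
          RandomConv.expMoment γ (RandomConv.convPow F n) ^ m
        ≤ liminf (fun x => RandomConv.tail (RandomConv.randomConv P τ F) x /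
            RandomConv.tail (RandomConv.convPow F n) x) atTop ∧
    (RandomConv.expMoment γ (RandomConv.convPow F n) = ∞ → 0 < P {ω | n < τ ω} →
      RandomConv.TailLittleO (RandomConv.convPow F n) (RandomConv.randomConv P τ F)) := by
  have hmemF := ae_mem_argSet hspan
  obtain ⟨H, hH, hHm⟩ := exists_addSubgroup_eq_argSet γ (convPow F n)
  have hmem (k : ℕ) : ∀ᵐ y ∂(convPow F k), y ∈ argSet γ (convPow F n) := by
    rw [← hH] at hmemF ⊢
    exact convPow_mem H hHm hmemF k
  have hp : ∑' k, prob P τ k ≤ 1 := (tsum_prob hτ).le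
  rw [randomConv_eq_mixture]
  obtain ⟨k₀, hk₀, hpk₀⟩ := exists_prob_ne_zero hpos
  obtain ⟨A, hA, hAn⟩ := exists_tail_convPow_le_mixture hF hk₀ hpk₀
  have hb := hL.shiftBounded
  refine ⟨?_, tsum_le_liminf_tail_mixture hF hn hL hmem, fun hM hgt => ?_⟩
  · have hfin (x : ℝ) : tail (mixture (prob P τ) F) x ≠ ∞ :=
      ((mixture_le_one hp _ measurableSet_Ioi).trans_lt ENNReal.one_lt_top).ne
    have hne (x : ℝ) : tail (mixture (prob P τ) F) x ≠ 0 := fun h0 =>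
      hL.tail_ne_zero x (by simpa [h0] using hAn x)
    refine classL_of_tendsto (H := H)
      ((argSet_mixture_subset hL hspan (hn.trans hk₀) hpk₀).trans hH.ge) hne hfin
      fun t htH ht0 => ?_
    have ht : t ∈ argSet γ (convPow F n) := hH.le htH
    have hlt (i : ℕ) (hi : i < n) := shift_convPow_of_lt hF hL hspan hcond hi ht ht0
    have hts := htail.mixtureTailSumCond
    exact tendsto_of_shift (expFactor_ne_top γ t) hne hfin
      (shiftUpper_mixture hF hn hp hA hAn hb ht0.le hts
        (shiftUpper_convPow hF hn ht0.le hb (hL.shiftUpper ht) fun i hi => (hlt i hi).1))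
      (shiftLower_mixture hF hn hp hA hAn hb ht0.le (expFactor_ne_top γ t) hts
        (shiftLower_convPow hF hn ht0.le (expFactor_ne_top γ t) hb (hL.shiftLower ht)
          fun i hi => (hlt i hi).2))
  · obtain ⟨k, hk, hpk⟩ := exists_prob_ne_zero (m := n + 1) hgt
    exact tailLittleO_mixture hF hL hmemF hM hk hpk
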